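/- **Theorem (Mattei–Moussu).** Let $\lambda\in\mathbb{R}_{\le 0}$ (saddles for $\lambda<0$; for $\lambda=0$, saddle-nodes whose central manifold is convergent and straightened to $\{x=0\}$), let $r>0$, $\Delta=\{(x,0):|x|<r\}\subset\mathbb{C}^2$ and $\Delta^*=\Delta\setminus\{(0,0)\}$. Let $f_1,f_2$ be holomorphic functions near $\Delta$ with $f_i(x,0)=0$ for $|x|<r$, and let $\mathcal{F}_i=\ker\omega_i$ be the foliation defined by $$\omega_i=x\,dy-(\lambda+f_i(x,y))\,y\,dx,\qquad i=1,2.$$ Fix $p=(x_0,0)\in\Delta^*$. A *minimal first integral* of $\mathcal{F}_i$ at $p$ is a holomorphic germ $H$ at $p$ with $H(p)=0$, $dH(p)\neq0$ and $dH\wedge\omega_i=0$. Its analytic continuation along the loop $t\mapsto(x_0e^{2i\pi t},0)$, $t\in[0,1]$, is $\varphi\circ H$ for some $\varphi\in\mathrm{Diff}(\mathbb{C},0)$, called the monodromy of $H$. The *holonomy* of $\mathcal{F}_i$ along $\Delta^*$ is the conjugacy class of $\varphi$ in $\mathrm{Diff}(\mathbb{C},0)$; it does not depend on the choice of $H$.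 1. If $\mathcal{F}_1$ and $\mathcal{F}_2$ have the same holonomy along $\Delta^*$, then there are a constant $c\in\mathbb{C}^*$, open neighbourhoods $U_1,U_2$ of $\Delta$ and an analytic diffeomorphism $\Phi:U_1\to U_2$ of the form $\Phi(x,y)=(x,\,c\,y+o(y))$ conjugating the foliations, i.e. $\Phi^*\omega_2\wedge\omega_1=0$ on $U_1$. 2. If moreover there are minimal first integrals $H_1$ of $\mathcal{F}_1$ and $H_2$ of $\mathcal{F}_2$ at $p$ which have the same monodromy and satisfy $dH_1(p)=dH_2(p)$ (for instance $H_1(x_0,y)=H_2(x_0,y)=y$), then $\Phi$ can be chosen of the form $\Phi(x,y)=(x,\,y+o(y))$. -/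

import Mathlib

open Filter Topology

namespace SaddleFoliation

noncomputable section

/-- The disc `Δ = {(x, 0) ; |x| < r}` in the `x`-axis of `ℂ²`. -/
def axisDisc (r : ℝ) : Set (ℂ × ℂ) := {p | ‖p.1‖ < r ∧ p.2 = 0}

/-- The value at `p = (x, y)` of the 1-form `ω = x dy - (lam + f(x, y)) y dx`. -/
def form (lam : ℂ) (f : ℂ × ℂ → ℂ) (p : ℂ × ℂ) : ℂ × ℂ →L[ℂ] ℂ :=
  p.1 • ContinuousLinearMap.snd ℂ ℂ ℂ -
    ((lam + f p) * p.2) • ContinuousLinearMap.fst ℂ ℂ ℂ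

/-- `α ∧ β = 0` for two covectors `α`, `β` on `ℂ²`. -/
def WedgeZero (α β : ℂ × ℂ →L[ℂ] ℂ) : Prop :=
  ∀ u v : ℂ × ℂ, α u * β v - α v * β u = 0

/-- The value at `p` of the pull-back `Φ^* ω` of a field of covectors. -/
def pullback (Φ : ℂ × ℂ → ℂ × ℂ) (ω : ℂ × ℂ → (ℂ × ℂ →L[ℂ] ℂ)) (p : ℂ × ℂ) :
    ℂ × ℂ →L[ℂ] ℂ :=
  (ω (Φ p)).comp (fderiv ℂ Φ p)

/-- `φ` represents an element of the group `Diff(ℂ, 0)` of germs of analytic diffeomorphisms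
fixing `0`. -/
def IsDiffGerm (φ : ℂ → ℂ) : Prop :=
  AnalyticAt ℂ φ 0 ∧ φ 0 = 0 ∧ deriv φ 0 ≠ 0

/-- `H` represents a minimal first integral, vanishing at `p`, of the foliation `ker ω`,
`ω = x dy - (lam + f) y dx`, at the point `p`: an analytic germ with `H p = 0`, `dH ≠ 0` at `p`
and `dH ∧ ω = 0` near `p`. -/
def IsMinimalFirstIntegral (lam : ℂ) (f : ℂ × ℂ → ℂ) (H : ℂ × ℂ → ℂ) (p : ℂ × ℂ) : Prop :=
  AnalyticAt ℂ H p ∧ H p = 0 ∧ fderiv ℂ H p ≠ 0 ∧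
    ∀ᶠ q in 𝓝 p, WedgeZero (fderiv ℂ H q) (form lam f q)

/-- The loop `t ↦ (x₀ exp (2 i π t), 0)`, `t ∈ [0, 1]`, of index one in the punctured disc. -/
def loop (x₀ : ℂ) (t : ℝ) : ℂ × ℂ :=
  (x₀ * Complex.exp (2 * Real.pi * Complex.I * t), 0)

/-- `(H t)`, `t ∈ [0, 1]`, is an analytic continuation along `γ` of a minimal first integral of
`ker (x dy - (lam + f) y dx)`: `H t` is a germ of minimal first integral at `γ t`, and for `s`
close to `t` the germ `H s` at `γ s` is the one defined by the function `H t`. -/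
def IsContinuationAlong (lam : ℂ) (f : ℂ × ℂ → ℂ) (γ : ℝ → ℂ × ℂ) (H : ℝ → ℂ × ℂ → ℂ) : Prop :=
  ∀ t ∈ Set.Icc (0 : ℝ) 1, IsMinimalFirstIntegral lam f (H t) (γ t) ∧
    ∀ᶠ s in 𝓝[Set.Icc (0 : ℝ) 1] t, H s =ᶠ[𝓝 (γ s)] H t

/-- `h` is a minimal first integral at `(x₀, 0)`, and `φ ∈ Diff(ℂ, 0)` is its monodromy along
the loop `(x₀ exp (2 i π t), 0)`: analytic continuation of `h` along the loop leads to `φ ∘ h`. -/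
def HasMonodromy (lam : ℂ) (f : ℂ × ℂ → ℂ) (x₀ : ℂ) (h : ℂ × ℂ → ℂ) (φ : ℂ → ℂ) : Prop :=
  IsDiffGerm φ ∧ ∃ H : ℝ → ℂ × ℂ → ℂ, IsContinuationAlong lam f (loop x₀) H ∧
    H 0 =ᶠ[𝓝 (x₀, 0)] h ∧ H 1 =ᶠ[𝓝 (x₀, 0)] φ ∘ h

/-- The foliations `ker (x dy - (lam + fᵢ) y dx)` have the same holonomy along the punctured disc,
the holonomy being the class up to conjugacy in `Diff(ℂ, 0)` of the monodromy of a minimal first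
integral. -/
def SameHolonomy (lam : ℂ) (f₁ f₂ : ℂ × ℂ → ℂ) (x₀ : ℂ) : Prop :=
  ∃ (h₁ h₂ : ℂ × ℂ → ℂ) (φ₁ φ₂ ψ : ℂ → ℂ),
    HasMonodromy lam f₁ x₀ h₁ φ₁ ∧ HasMonodromy lam f₂ x₀ h₂ φ₂ ∧
      IsDiffGerm ψ ∧ ψ ∘ φ₁ =ᶠ[𝓝 0] φ₂ ∘ ψ

/-- The foliations have the same holonomy representative for first integrals with the same
differential at `(x₀, 0)` (for instance, both equal to `y` on the transversal `x = x₀`). -/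
def SameNormalizedHolonomy (lam : ℂ) (f₁ f₂ : ℂ × ℂ → ℂ) (x₀ : ℂ) : Prop :=
  ∃ (h₁ h₂ : ℂ × ℂ → ℂ) (φ : ℂ → ℂ),
    HasMonodromy lam f₁ x₀ h₁ φ ∧ HasMonodromy lam f₂ x₀ h₂ φ ∧
      fderiv ℂ h₁ (x₀, 0) = fderiv ℂ h₂ (x₀, 0)

/-- There is an analytic diffeomorphism `Φ(x, y) = (x, c y + o(y))` between open neighbourhoods
`U₁`, `U₂` of the disc `Δ` such that `Φ^* ω₂ ∧ ω₁ = 0`, where `ωᵢ = x dy - (lam + fᵢ) y dx` is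
analytic on `Uᵢ`. -/
def FiberedConjugate (r : ℝ) (lam : ℂ) (f₁ f₂ : ℂ × ℂ → ℂ) (c : ℂ) : Prop :=
  ∃ (U₁ U₂ : Set (ℂ × ℂ)) (Φ Ψ : ℂ × ℂ → ℂ × ℂ),
    IsOpen U₁ ∧ IsOpen U₂ ∧ axisDisc r ⊆ U₁ ∧ axisDisc r ⊆ U₂ ∧
    AnalyticOnNhd ℂ f₁ U₁ ∧ AnalyticOnNhd ℂ f₂ U₂ ∧
    AnalyticOnNhd ℂ Φ U₁ ∧ AnalyticOnNhd ℂ Ψ U₂ ∧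
    Set.MapsTo Φ U₁ U₂ ∧ Set.MapsTo Ψ U₂ U₁ ∧ Set.InvOn Ψ Φ U₁ U₂ ∧
    (∀ p ∈ U₁, (Φ p).1 = p.1) ∧
    (∀ x : ℂ, ‖x‖ < r → (fun y : ℂ => (Φ (x, y)).2 - c * y) =o[𝓝 0] fun y : ℂ => y) ∧
    ∀ p ∈ U₁, WedgeZero (pullback Φ (form lam f₂) p) (form lam f₁ p)

end

end SaddleFoliation

open SaddleFoliation

/-!
On the universal cover `x = x₀ * exp t` of the punctured disc, each foliation has a first integral
`H (t, y) = ∑ h n (t) * y ^ n` with `H (0, y) = y`. Its coefficients solve a triangular linear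
system of differential equations on a half-plane `{re t < a}`
(`exists_firstIntegral_coeffs`, `exists_coverFirstIntegral`). Continuing a minimal first integral
along the loop amounts to translating by `2 * π * I` (`HasMonodromy.translate`). Hence equality of
the holonomies provides germs `E₁`, `E₂` such that `E₁ ∘ H₁` and `E₂ ∘ H₂` are transformed by the
same monodromy, and the solution `φ` of `E₂ (H₂ (t, φ)) = E₁ (H₁ (t, y))` is `2 * π * I`-periodic
in `t`: it is a power series `∑ c n (x) * y ^ n` whose coefficients are holomorphic on the punctured
disc.

The point is the extension to `x = 0`, and this is where `lam ≤ 0` is used. A majorant argument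
(`norm_quadratures_le`) shows that, for every `ε > 0`, the first integrals are univalent on the
fibre over `x` on a disc of radius comparable to `‖x‖ ^ ε`; by Cauchy's estimates
`c n (x) = O(‖x‖ ^ (-n * ε))` (`exists_transition_coeff_bound`). As `ε` is arbitrary, every `c n`
has a removable singularity at the origin (`exists_descent`). The maximum principle then bounds
`c n` on a whole disc by its bound on the boundary circle, which is geometric in `n`, so that the
series converges on a neighbourhood of the origin too (`exists_transition_map`). The inverse map is
obtained by exchanging the foliations, and the identities it has to satisfy hold over the punctured
disc, hence at the origin by the identity theorem.
-/

namespace SaddleFoliation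

/-! ### Partial derivatives and Taylor coefficients along the fibres -/

/-- The partial derivative `∂F/∂x` of a function of two complex variables. -/
noncomputable def partialX (F : ℂ × ℂ → ℂ) (p : ℂ × ℂ) : ℂ := fderiv ℂ F p (1, 0)

/-- The partial derivative `∂F/∂y` of a function of two complex variables. -/
noncomputable def partialY (F : ℂ × ℂ → ℂ) (p : ℂ × ℂ) : ℂ := fderiv ℂ F p (0, 1)

/-- The coefficient of `y ^ n` in the Taylor expansion of `y ↦ F (x, y)` at `0`. -/
noncomputable def fiberCoeff (F : ℂ × ℂ → ℂ) (n : ℕ) (x : ℂ) : ℂ :=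
  (n.factorial : ℂ)⁻¹ * iteratedDeriv n (fun y => F (x, y)) 0

lemma fderiv_apply_eq (F : ℂ × ℂ → ℂ) (p u : ℂ × ℂ) :
    fderiv ℂ F p u = u.1 * partialX F p + u.2 * partialY F p := by
  have : u = u.1 • ((1 : ℂ), (0 : ℂ)) + u.2 • ((0 : ℂ), (1 : ℂ)) := by
    ext <;> simp
  conv_lhs => rw [this]
  rw [map_add, map_smul, map_smul]
  rfl

lemma analyticAt_partialX {F : ℂ × ℂ → ℂ} {p : ℂ × ℂ} (hF : AnalyticAt ℂ F p) :
    AnalyticAt ℂ (partialX F) p := by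
  exact ((ContinuousLinearMap.apply ℂ ℂ ((1 : ℂ), (0 : ℂ))).analyticAt _).comp hF.fderiv

lemma analyticAt_partialY {F : ℂ × ℂ → ℂ} {p : ℂ × ℂ} (hF : AnalyticAt ℂ F p) :
    AnalyticAt ℂ (partialY F) p := by
  exact ((ContinuousLinearMap.apply ℂ ℂ ((0 : ℂ), (1 : ℂ))).analyticAt _).comp hF.fderiv

/-- Chain rule for `F (u s, v s)`. -/
lemma hasDerivAt_comp_pair {F : ℂ × ℂ → ℂ} {u v : ℂ → ℂ} {s u' v' : ℂ}
    (hF : DifferentiableAt ℂ F (u s, v s)) (hu : HasDerivAt u u' s) (hv : HasDerivAt v v' s) :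
    HasDerivAt (fun s => F (u s, v s))
      (u' * partialX F (u s, v s) + v' * partialY F (u s, v s)) s := by
  have h := HasFDerivAt.comp_hasDerivAt (f := fun s => (u s, v s)) s hF.hasFDerivAt
    (hu.prodMk hv)
  rw [fderiv_apply_eq] at h
  exact h

lemma hasDerivAt_partialX {F : ℂ × ℂ → ℂ} {x y : ℂ} (hF : DifferentiableAt ℂ F (x, y)) :
    HasDerivAt (fun x => F (x, y)) (partialX F (x, y)) x := by
  simpa using hasDerivAt_comp_pair (u := id) (v := fun _ => y) hF (hasDerivAt_id x)
    (hasDerivAt_const x y)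

lemma hasDerivAt_partialY {F : ℂ × ℂ → ℂ} {x y : ℂ} (hF : DifferentiableAt ℂ F (x, y)) :
    HasDerivAt (fun y => F (x, y)) (partialY F (x, y)) y := by
  simpa using hasDerivAt_comp_pair (u := fun _ => x) (v := id) hF (hasDerivAt_const y x)
    (hasDerivAt_id y)

lemma continuous_pair_left (y : ℂ) : Continuous fun x : ℂ => (x, y) := by fun_prop

lemma continuous_pair_right (x : ℂ) : Continuous fun y : ℂ => (x, y) := by fun_prop

/-- A property of the germ at `(x, y)` gives a property on the fibre over `x`. -/
lemma eventually_fiber {P : ℂ × ℂ → Prop} {x y : ℂ} (h : ∀ᶠ p in 𝓝 (x, y), P p) :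
    ∀ᶠ z in 𝓝 y, P (x, z) :=
  (continuous_pair_right x).continuousAt.eventually h

/-- A property of the germ at `(x, y)` gives a property on the horizontal line through it. -/
lemma eventually_base {P : ℂ × ℂ → Prop} {x y : ℂ} (h : ∀ᶠ p in 𝓝 (x, y), P p) :
    ∀ᶠ z in 𝓝 x, P (z, y) :=
  (continuous_pair_left y).continuousAt.eventually h

/-- Taylor coefficients along the fibres are given by iterated partial derivatives, so that they
depend analytically on `x`. -/
lemma iteratedDeriv_fiber {F : ℂ × ℂ → ℂ} {x : ℂ} (n : ℕ) :
    ∀ y, AnalyticAt ℂ F (x, y) →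
      AnalyticAt ℂ (partialY^[n] F) (x, y) ∧
        iteratedDeriv n (fun y => F (x, y)) y = (partialY^[n] F) (x, y) := by
  induction n with
  | zero => intro y h; simp [h]
  | succ n ih =>
    intro y h
    rw [Function.iterate_succ_apply']
    refine ⟨analyticAt_partialY (ih y h).1, ?_⟩
    rw [iteratedDeriv_succ]
    have h1 : iteratedDeriv n (fun y => F (x, y)) =ᶠ[𝓝 y] fun y => (partialY^[n] F) (x, y) := by
      filter_upwards [eventually_fiber h.eventually_analyticAt] with z hz using (ih z hz).2
    rw [h1.deriv_eq]
    exact (hasDerivAt_partialY (ih y h).1.differentiableAt).deriv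

lemma analyticAt_fiberCoeff {F : ℂ × ℂ → ℂ} {x : ℂ} (hF : AnalyticAt ℂ F (x, 0)) (n : ℕ) :
    AnalyticAt ℂ (fiberCoeff F n) x := by
  have h1 : fiberCoeff F n =ᶠ[𝓝 x]
      fun x => (n.factorial : ℂ)⁻¹ * (partialY^[n] F) (x, 0) := by
    filter_upwards [eventually_base hF.eventually_analyticAt] with z hz
    rw [fiberCoeff, (iteratedDeriv_fiber n 0 hz).2]
  refine AnalyticAt.congr ?_ h1.symm
  have h2 : AnalyticAt ℂ (fun x : ℂ => (x, (0 : ℂ))) x := analyticAt_id.prod analyticAt_const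
  exact analyticAt_const.mul ((iteratedDeriv_fiber n 0 hF).1.comp_of_eq h2 rfl)

lemma fiberCoeff_congr {F G : ℂ × ℂ → ℂ} {x x' : ℂ} (n : ℕ)
    (h : ∀ᶠ y in 𝓝 0, F (x, y) = G (x', y)) : fiberCoeff F n x = fiberCoeff G n x' := by
  rw [fiberCoeff, fiberCoeff,
    Filter.EventuallyEq.iteratedDeriv_eq n (f := fun y => F (x, y)) (g := fun y => G (x', y)) h]

lemma fiberCoeff_zero (F : ℂ × ℂ → ℂ) (x : ℂ) : fiberCoeff F 0 x = F (x, 0) := by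
  simp [fiberCoeff]

lemma fiberCoeff_one {F : ℂ × ℂ → ℂ} {x : ℂ} (hF : AnalyticAt ℂ F (x, 0)) :
    fiberCoeff F 1 x = partialY F (x, 0) := by
  rw [fiberCoeff, (iteratedDeriv_fiber 1 0 hF).2]
  simp

/-- Cauchy's estimates for the Taylor coefficients of a function which coincides near `0`, on the
fibre over `x`, with a bounded holomorphic function on a disc. -/
lemma norm_fiberCoeff_le {F : ℂ × ℂ → ℂ} {x : ℂ} {N : ℂ → ℂ} {R C : ℝ} (hR : 0 < R)
    (hN : DifferentiableOn ℂ N (Metric.ball 0 R)) (hC : ∀ y ∈ Metric.ball (0 : ℂ) R, ‖N y‖ ≤ C)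
    (hF : ∀ᶠ y in 𝓝 0, F (x, y) = N y) (n : ℕ) :
    ‖fiberCoeff F n x‖ ≤ C * (2 / R) ^ n := by
  have h1 : fiberCoeff F n x = (n.factorial : ℂ)⁻¹ * iteratedDeriv n N 0 := by
    rw [fiberCoeff, Filter.EventuallyEq.iteratedDeriv_eq n (f := fun y => F (x, y)) (g := N) hF]
  have hsub : Metric.closedBall (0 : ℂ) (R / 2) ⊆ Metric.ball 0 R :=
    Metric.closedBall_subset_ball (by linarith)
  have h2 := Complex.norm_iteratedDeriv_le_of_forall_mem_sphere_norm_le n (half_pos hR)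
    ((hN.mono hsub).diffContOnCl_ball subset_rfl)
    (fun z hz => hC z (hsub (Metric.sphere_subset_closedBall hz)))
  have h3 : (0 : ℝ) < n.factorial := by positivity
  rw [h1, norm_mul, norm_inv, Complex.norm_natCast, inv_mul_le_iff₀ h3]
  refine h2.trans (le_of_eq ?_)
  rw [div_pow, div_pow]
  field_simp

lemma hasSum_fiberCoeff {F : ℂ × ℂ → ℂ} {x : ℂ} {R : ℝ}
    (hF : DifferentiableOn ℂ (fun y => F (x, y)) (Metric.ball 0 R)) {y : ℂ} (hy : ‖y‖ < R) :
    HasSum (fun n => fiberCoeff F n x * y ^ n) (F (x, y)) := by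
  have h := Complex.hasSum_taylorSeries_on_ball hF (z := y) (by simpa using hy)
  have h' : (fun n => fiberCoeff F n x * y ^ n) = fun n : ℕ =>
      (n.factorial : ℂ)⁻¹ • (y - 0) ^ n • iteratedDeriv n (fun y => F (x, y)) 0 := by
    ext n
    rw [fiberCoeff, sub_zero, smul_eq_mul, smul_eq_mul]
    ring
  rw [h']
  exact h

/-! ### Power series in `y` with holomorphic coefficients -/

/-- A power series in `y` whose coefficients are holomorphic in `t` and geometrically bounded is
analytic in both variables. The series is the pairing of an `ℓ²`-valued holomorphic function of `t`
with a holomorphic function of `y` valued in the dual of `ℓ²`. -/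
theorem analyticAt_tsum_mul_pow {c : ℕ → ℂ → ℂ} {W : Set ℂ} (hW : IsOpen W)
    (hc : ∀ n, DifferentiableOn ℂ (c n) W) {C A : ℝ}
    (hb : ∀ n, ∀ t ∈ W, ‖c n t‖ ≤ C * A ^ n) (hA : 0 < A) {t y : ℂ} (ht : t ∈ W)
    (hy : A * ‖y‖ < 1) :
    AnalyticAt ℂ (fun p : ℂ × ℂ => ∑' n, c n p.1 * p.2 ^ n) (t, y) := by
  obtain ⟨R, hyR, hRA⟩ : ∃ R, ‖y‖ < R ∧ R < A⁻¹ := exists_between (by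
    rw [inv_eq_one_div]
    exact (lt_div_iff₀' hA).2 hy)
  have hR : 0 < R := (norm_nonneg y).trans_lt hyR
  have hRA' : A * R < 1 := by rwa [← lt_inv_mul_iff₀ hA, mul_one]
  obtain ⟨S, hyS, hSR⟩ := exists_between hyR
  have hS : 0 < S := (norm_nonneg y).trans_lt hyS
  let E := lp (fun _ : ℕ => ℂ) 2
  let e : ℕ → E := fun n => lp.single 2 n (1 : ℂ)
  have he : ∀ n, ‖e n‖ = 1 := fun n =>
    (lp.norm_single (E := fun _ : ℕ => ℂ) (p := 2) (by norm_num) n (1 : ℂ)).trans norm_one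
  let q : ℕ → E →L[ℂ] ℂ := fun n => lp.evalCLM ℂ (fun _ : ℕ => ℂ) 2 n
  have hq : ∀ n, ‖q n‖ ≤ 1 := fun n =>
    ContinuousLinearMap.opNorm_le_bound _ zero_le_one fun x => by
      rw [one_mul]; exact lp.norm_apply_le_norm (by norm_num) x n
  have hqe : ∀ n m, q n (e m) = if n = m then 1 else 0 := by
    intro n m
    change (lp.single 2 m (1 : ℂ) : E) n = _
    split_ifs with h
    · subst h; exact lp.single_apply_self _ _ _
    · exact lp.single_apply_ne _ _ _ h
  let T : ℂ → E := fun t => ∑' n, (c n t * R ^ n) • e n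
  let Q : ℂ → E →L[ℂ] ℂ := fun y => ∑' n, (y / R) ^ n • q n
  have hsT : Summable fun n : ℕ => C * (A * R) ^ n :=
    (summable_geometric_of_lt_one (by positivity) hRA').mul_left C
  have hbT : ∀ n, ∀ t ∈ W, ‖(c n t * R ^ n) • e n‖ ≤ C * (A * R) ^ n := by
    intro n t ht
    rw [norm_smul, he, mul_one, norm_mul, norm_pow, Complex.norm_real, Real.norm_of_nonneg hR.le,
      mul_pow, ← mul_assoc]
    exact mul_le_mul_of_nonneg_right (hb n t ht) (by positivity)
  have hT : AnalyticAt ℂ T t := by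
    refine DifferentiableOn.analyticAt (s := W) ?_ (hW.mem_nhds ht)
    exact Complex.differentiableOn_tsum_of_summable_norm hsT
      (fun n => ((hc n).mul_const _).smul_const _) hW hbT
  have hsQ : Summable fun n : ℕ => (S / R) ^ n :=
    summable_geometric_of_lt_one (by positivity) ((div_lt_one hR).2 hSR)
  have hbQ : ∀ n : ℕ, ∀ y ∈ Metric.ball (0 : ℂ) S, ‖(y / R) ^ n • q n‖ ≤ (S / R) ^ n := by
    intro n y hy
    rw [norm_smul, norm_pow, norm_div, Complex.norm_real, Real.norm_of_nonneg hR.le]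
    refine (mul_le_of_le_one_right (by positivity) (hq n)).trans ?_
    have : ‖y‖ ≤ S := by simpa using (Metric.mem_ball.1 hy).le
    gcongr
  have hyS' : y ∈ Metric.ball (0 : ℂ) S := by simpa using hyS
  have hQ : AnalyticAt ℂ Q y := by
    refine DifferentiableOn.analyticAt (s := Metric.ball 0 S) ?_
      (Metric.isOpen_ball.mem_nhds hyS')
    exact Complex.differentiableOn_tsum_of_summable_norm hsQ
      (fun n => by fun_prop) Metric.isOpen_ball hbQ
  have hQT : AnalyticAt ℂ (fun p : ℂ × ℂ => Q p.2 (T p.1)) (t, y) :=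
    ((ContinuousLinearMap.id ℂ (E →L[ℂ] ℂ)).analyticAt_bilinear (Q y, T t)).comp_of_eq
      ((hQ.comp_of_eq (g := Q) (f := fun p : ℂ × ℂ => p.2) (x := (t, y)) analyticAt_snd rfl).prod
      (hT.comp_of_eq (g := T) (f := fun p : ℂ × ℂ => p.1) (x := (t, y)) analyticAt_fst rfl)) rfl
  refine hQT.congr ?_
  filter_upwards [(hW.prod Metric.isOpen_ball).mem_nhds (Set.mk_mem_prod ht hyS')] with p hp
  have h1 : Summable fun n : ℕ => (p.2 / R) ^ n • q n :=
    Summable.of_norm_bounded hsQ fun n => hbQ n _ hp.2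
  have h2 : Summable fun n : ℕ => (c n p.1 * R ^ n) • e n :=
    Summable.of_norm_bounded hsT fun n => hbT n _ hp.1
  have h3 : ∀ n, q n (T p.1) = c n p.1 * R ^ n := by
    intro n
    rw [(q n).map_tsum h2, tsum_eq_single n]
    · simp [hqe]
    · intro m hm; simp [hqe, hm.symm]
  have h4 : Q p.2 (T p.1) = ∑' n, ((p.2 / R) ^ n • q n) (T p.1) :=
    (ContinuousLinearMap.apply ℂ ℂ (T p.1)).map_tsum h1
  rw [h4]
  refine tsum_congr fun n => ?_
  have : (R : ℂ) ≠ 0 := by exact_mod_cast hR.ne'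
  rw [_root_.smul_apply, h3, smul_eq_mul, div_pow]
  field_simp

/-! ### Straightening a function along the fibres -/

/-- If `G` vanishes at `(t, 0)` and `∂G/∂y ≠ 0` there, then `(x, y) ↦ (x, G (x, y))` has an
analytic local inverse `(x, w) ↦ (x, Y (x, w))`. -/
theorem exists_fiber_inverse {G : ℂ × ℂ → ℂ} {t : ℂ} (hG : AnalyticAt ℂ G (t, 0))
    (h0 : G (t, 0) = 0) (hy : partialY G (t, 0) ≠ 0) :
    ∃ Y : ℂ × ℂ → ℂ, AnalyticAt ℂ Y (t, 0) ∧ (∀ᶠ p in 𝓝 (t, (0 : ℂ)), G (p.1, Y p) = p.2) ∧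
      ∀ᶠ p in 𝓝 (t, (0 : ℂ)), Y (p.1, G p) = p.2 := by
  set β := partialY G (t, 0) with hβ
  let Θ : ℂ × ℂ → ℂ × ℂ := fun p => (p.1, G p)
  have hΘ : AnalyticAt ℂ Θ (t, 0) := analyticAt_fst.prod hG
  let L : ℂ × ℂ →L[ℂ] ℂ × ℂ := (ContinuousLinearMap.fst ℂ ℂ ℂ).prod (fderiv ℂ G (t, 0))
  let L' : ℂ × ℂ →L[ℂ] ℂ × ℂ := (ContinuousLinearMap.fst ℂ ℂ ℂ).prod
    (β⁻¹ • (ContinuousLinearMap.snd ℂ ℂ ℂ - partialX G (t, 0) • ContinuousLinearMap.fst ℂ ℂ ℂ))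
  let i : (ℂ × ℂ) ≃L[ℂ] ℂ × ℂ := ContinuousLinearEquiv.equivOfInverse L L'
    (fun u => by
      ext
      · simp [L, L']
      · simp only [ContinuousLinearMap.prod_apply, ContinuousLinearMap.coe_fst',
          _root_.smul_apply, _root_.sub_apply,
          ContinuousLinearMap.coe_snd', smul_eq_mul, fderiv_apply_eq, L, L']
        rw [← hβ]; field_simp; ring)
    (fun u => by
      ext
      · simp [L, L']
      · simp only [ContinuousLinearMap.prod_apply, ContinuousLinearMap.coe_fst',
          _root_.smul_apply, _root_.sub_apply,
          ContinuousLinearMap.coe_snd', smul_eq_mul, fderiv_apply_eq, L, L']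
        rw [← hβ]; field_simp; ring)
  have hΘ' : HasFDerivAt Θ (i : ℂ × ℂ →L[ℂ] ℂ × ℂ) (t, 0) :=
    hasFDerivAt_fst.prodMk hG.differentiableAt.hasFDerivAt
  have hs : HasStrictFDerivAt Θ (i : ℂ × ℂ →L[ℂ] ℂ × ℂ) (t, 0) := by
    have := hΘ.hasStrictFDerivAt
    rwa [hΘ'.fderiv] at this
  have hΘt : Θ (t, 0) = (t, 0) := by simp [Θ, h0]
  let Z := hs.localInverse Θ i (t, 0)
  have hZ : AnalyticAt ℂ Z (t, 0) := by
    have := (hs.toOpenPartialHomeomorph Θ).analyticAt_symm'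
      hs.mem_toOpenPartialHomeomorph_source hΘ hΘ'.fderiv
    rwa [HasStrictFDerivAt.toOpenPartialHomeomorph_coe, hΘt] at this
  have hr : ∀ᶠ p in 𝓝 (t, (0 : ℂ)), Θ (Z p) = p := by
    have := hs.eventually_right_inverse
    rwa [hΘt] at this
  refine ⟨fun p => (Z p).2, analyticAt_snd.comp hZ, ?_, ?_⟩
  · filter_upwards [hr] with p hp
    have h1 : (Z p).1 = p.1 := (congrArg Prod.fst hp : (Θ (Z p)).1 = p.1)
    have h2 : G (Z p) = p.2 := (congrArg Prod.snd hp : (Θ (Z p)).2 = p.2)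
    rw [← h1]; exact h2
  · filter_upwards [hs.eventually_left_inverse] with p hp
    exact congrArg Prod.snd hp

/-- The germ of an analytic function of one variable at a zero of order one has an analytic
inverse. -/
lemma exists_germ_inverse {E : ℂ → ℂ} (hE : AnalyticAt ℂ E 0) (h0 : E 0 = 0)
    (h1 : deriv E 0 ≠ 0) :
    ∃ K : ℂ → ℂ, AnalyticAt ℂ K 0 ∧ K 0 = 0 ∧ (∀ᶠ w in 𝓝 0, E (K w) = w) ∧
      ∀ᶠ w in 𝓝 0, K (E w) = w := by
  have hs := hE.hasStrictDerivAt
  refine ⟨hs.localInverse _ _ _ h1, ?_, ?_, ?_, ?_⟩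
  · simpa [h0] using hE.analyticAt_localInverse h1
  · simpa [h0] using HasStrictFDerivAt.localInverse_apply_image (hs.hasStrictFDerivAt_equiv h1)
  · simpa [h0] using HasStrictDerivAt.eventually_right_inverse hs h1
  · exact HasStrictDerivAt.eventually_left_inverse hs h1

/-! ### The coefficients of a first integral on the universal cover -/

/-- Uniform bounds for the Taylor coefficients along the fibres, over a smaller closed disc. -/
lemma exists_fiberCoeff_bound {r : ℝ} {f : ℂ × ℂ → ℂ} (hf : AnalyticOnNhd ℂ f (axisDisc r))
    {ρ : ℝ} (hρ : ρ < r) :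
    ∃ F : ℝ, 0 < F ∧ ∀ x : ℂ, ‖x‖ ≤ ρ → (∀ n, 1 ≤ n → ‖fiberCoeff f n x‖ ≤ F ^ n) ∧
      ∀ y : ℂ, F * ‖y‖ < 1 → HasSum (fun n => fiberCoeff f n x * y ^ n) (f (x, y)) := by
  have hK : IsCompact (Metric.closedBall (0 : ℂ) ρ ×ˢ {(0 : ℂ)}) :=
    (isCompact_closedBall _ _).prod isCompact_singleton
  have hU : IsOpen {p | AnalyticAt ℂ f p} := isOpen_analyticAt ℂ f
  have hKU : Metric.closedBall (0 : ℂ) ρ ×ˢ {(0 : ℂ)} ⊆ {p | AnalyticAt ℂ f p} := by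
    rintro ⟨x, y⟩ ⟨hx, hy⟩
    refine hf _ ⟨?_, hy⟩
    have : ‖x‖ ≤ ρ := by simpa using hx
    exact this.trans_lt hρ
  obtain ⟨δ, hδ, hδU⟩ := hK.exists_cthickening_subset_open hU hKU
  have hcont : ContinuousOn f (Metric.cthickening δ (Metric.closedBall (0 : ℂ) ρ ×ˢ {(0 : ℂ)})) :=
    fun p hp => (hδU hp).continuousAt.continuousWithinAt
  obtain ⟨M₀, hM₀⟩ := hK.cthickening.exists_bound_of_continuousOn hcont
  set M := max M₀ 1
  have hM1 : 1 ≤ M := le_max_right _ _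
  have hmem : ∀ x : ℂ, ‖x‖ ≤ ρ → ∀ y : ℂ, ‖y‖ < δ →
      (x, y) ∈ Metric.cthickening δ (Metric.closedBall (0 : ℂ) ρ ×ˢ {(0 : ℂ)}) := by
    intro x hx y hy
    refine Metric.mem_cthickening_of_dist_le (x, y) (x, 0) δ _ ⟨by simpa using hx, rfl⟩ ?_
    rw [Prod.dist_eq]
    simpa using hy.le
  have hd : ∀ x : ℂ, ‖x‖ ≤ ρ → DifferentiableOn ℂ (fun y => f (x, y)) (Metric.ball 0 δ) := by
    intro x hx y hy
    exact (hasDerivAt_partialY (hδU (hmem x hx y (by simpa using hy))).differentiableAt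
      ).differentiableAt.differentiableWithinAt
  refine ⟨M * (2 / δ), by positivity, fun x hx => ⟨fun n hn => ?_, fun y hy => ?_⟩⟩
  · refine (norm_fiberCoeff_le hδ (hd x hx) (C := M) (fun y hy => ?_)
      (Eventually.of_forall fun _ => rfl) n).trans ?_
    · exact (hM₀ _ (hmem x hx y (by simpa using hy))).trans (le_max_left _ _)
    · rw [mul_pow]
      have : M ≤ M ^ n := le_self_pow₀ hM1 (by omega)
      gcongr
  · refine hasSum_fiberCoeff (hd x hx) ?_
    have h1 : ‖y‖ * 2 / δ < 1 := by
      refine lt_of_le_of_lt ?_ hy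
      rw [mul_div_assoc, mul_comm ‖y‖, mul_assoc]
      exact le_mul_of_one_le_left (by positivity) hM1
    rw [div_lt_one hδ] at h1
    nlinarith [norm_nonneg y]

/-- The solution by quadratures of the triangular system
`(m n)' = -∑ j < n, j * a (n - j) * m j`, where `P g v` is a primitive of `g` with value `v` at the
base point. -/
noncomputable def quadratures (P : (ℂ → ℂ) → ℂ → ℂ → ℂ) (a : ℕ → ℂ → ℂ) : ℕ → ℂ → ℂ
  | n => P (fun t => -∑ j : Fin n, (j : ℂ) * a (n - j) t * quadratures P a j t)
      (if n = 1 then 1 else 0)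

/-- The triangular system has holomorphic solutions on every convex open set, as holomorphic
functions have primitives there. The value `1` at the base point for `n = 1` is the normalization
of the first integral. -/
lemma exists_quadratures {D : Set ℂ} (hD : Convex ℝ D) (hDo : IsOpen D) {a : ℕ → ℂ → ℂ}
    (ha : ∀ n, DifferentiableOn ℂ (a n) D) :
    ∃ m : ℕ → ℂ → ℂ,
      (∀ n, ∀ t ∈ D, HasDerivAt (m n) (-∑ j ∈ Finset.range n, (j : ℂ) * a (n - j) t * m j t) t) ∧
      ∀ n, m n 0 = if n = 1 then 1 else 0 := by
  have hprim : ∀ (g : ℂ → ℂ) (v : ℂ), ∃ G : ℂ → ℂ,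
      (DifferentiableOn ℂ g D → ∀ t ∈ D, HasDerivAt G (g t) t) ∧ G 0 = v := by
    intro g v
    by_cases hg : DifferentiableOn ℂ g D
    · obtain ⟨G, hG⟩ := hD.exists_forall_hasDerivWithinAt hg
      refine ⟨fun t => G t - G 0 + v, fun _ t ht => ?_, by simp⟩
      exact (((hG t ht).hasDerivAt (hDo.mem_nhds ht)).sub_const _).add_const _
    · exact ⟨fun _ => v, fun h => absurd h hg, rfl⟩
  choose P hP hP0 using hprim
  have hrec : ∀ n, quadratures P a n =
      P (fun t => -∑ j ∈ Finset.range n, (j : ℂ) * a (n - j) t * quadratures P a j t)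
        (if n = 1 then 1 else 0) := by
    intro n
    rw [quadratures]
    congr 1
    ext t
    rw [Finset.sum_range (fun j => (j : ℂ) * a (n - j) t * quadratures P a j t)]
  refine ⟨quadratures P a, fun n => ?_, fun n => by rw [hrec, hP0]⟩
  induction n using Nat.strong_induction_on with
  | _ n ih =>
    have hd : DifferentiableOn ℂ
        (fun t => -∑ j ∈ Finset.range n, (j : ℂ) * a (n - j) t * quadratures P a j t) D := by
      refine DifferentiableOn.fun_neg (DifferentiableOn.fun_sum fun j hj => ?_)
      refine ((ha _).const_mul _).mul fun t ht => ?_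
      exact (ih j (Finset.mem_range.1 hj) t ht).differentiableAt.differentiableWithinAt
    intro t ht
    have h := hP _ (if n = 1 then 1 else 0) hd t ht
    rwa [← hrec n] at h

lemma sum_range_pow_sub_le {q ε : ℝ} (hε : 0 < ε) (hq : q = ε / (1 + ε)) (k : ℕ) :
    ∑ i ∈ Finset.range k, q ^ (k - i) ≤ ε := by
  have hq0 : 0 ≤ q := by rw [hq]; positivity
  have h1 : ∑ i ∈ Finset.range k, q ^ (k - i) = ∑ i ∈ Finset.range k, q ^ (i + 1) := by
    rw [← Finset.sum_range_reflect]
    refine Finset.sum_congr rfl fun i hi => ?_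
    have := Finset.mem_range.1 hi
    congr 1; omega
  have h2 : ∀ k : ℕ, ∑ i ∈ Finset.range k, q ^ (i + 1) = ε * (1 - q ^ k) := by
    intro k
    induction k with
    | zero => simp
    | succ k ih =>
      rw [Finset.sum_range_succ, ih, pow_succ, hq]
      field_simp
      ring
  rw [h1, h2]
  have := pow_nonneg hq0 k
  nlinarith

/-- The majorant for the solution by quadratures: geometric bounds on the data along a segment
starting at the base point give geometric bounds on the solution. Up to the constant
`(1 + ε) / ε`, the ratio gets worse along the segment by a factor `exp (ε * ‖t‖)` only, with `ε` as
small as one likes. -/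
lemma norm_quadratures_le {a m : ℕ → ℂ → ℂ} {t : ℂ}
    (hm : ∀ n, ∀ u ∈ Set.Icc (0 : ℝ) 1, HasDerivAt (m n)
      (-∑ j ∈ Finset.range n, (j : ℂ) * a (n - j) (u * t) * m j (u * t)) (u * t))
    (hm0 : ∀ n, m n 0 = if n = 1 then 1 else 0) {F P ε : ℝ} (hF : 0 < F) (hε : 0 < ε)
    (ha : ∀ n, 1 ≤ n → ∀ u ∈ Set.Icc (0 : ℝ) 1, ‖a n (u * t)‖ ≤ (F * Real.exp (P * u)) ^ n)
    (hP : 0 ≤ P) (k : ℕ) :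
    ∀ u ∈ Set.Icc (0 : ℝ) 1,
      ‖m (k + 1) (u * t)‖ ≤ (F * (1 + ε) / ε * Real.exp ((ε * ‖t‖ + P) * u)) ^ k := by
  set B := F * (1 + ε) / ε with hB
  set κ := ε * ‖t‖ + P with hκ
  set E : ℝ → ℝ := fun u => B * Real.exp (κ * u) with hE
  have hB0 : 0 < B := by positivity
  have hκ0 : 0 ≤ κ := by positivity
  have hE0 : ∀ u, 0 < E u := fun u => by positivity
  have hEd : ∀ u, HasDerivAt E (κ * E u) u := by
    intro u
    have := (((hasDerivAt_id u).const_mul κ).exp).const_mul B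
    refine this.congr_deriv ?_
    simp only [hE, id]; ring
  have hFE : ∀ u ∈ Set.Icc (0 : ℝ) 1, F * Real.exp (P * u) ≤ F / B * E u := by
    intro u hu
    have h1 : Real.exp (P * u) ≤ Real.exp (κ * u) := by
      apply Real.exp_le_exp.2
      have : 0 ≤ ε * ‖t‖ * u := mul_nonneg (by positivity) hu.1
      rw [hκ]; nlinarith
    calc F * Real.exp (P * u) ≤ F * Real.exp (κ * u) := by gcongr
      _ = F / B * E u := by simp only [hE]; field_simp
  have hq : F / B = ε / (1 + ε) := by rw [hB]; field_simp
  induction k using Nat.strong_induction_on with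
  | _ k ih =>
    have hline : ∀ u : ℝ, HasDerivAt (fun u : ℝ => (u : ℂ) * t) t u := fun u => by
      simpa using (Complex.ofRealCLM.hasDerivAt (x := u)).mul_const t
    have hd : ∀ u ∈ Set.Icc (0 : ℝ) 1, HasDerivAt (fun u : ℝ => m (k + 1) (u * t))
        ((-∑ j ∈ Finset.range (k + 1), (j : ℂ) * a (k + 1 - j) (u * t) * m j (u * t)) * t) u :=
      fun u hu => (hm (k + 1) u hu).comp u (hline u)
    refine image_norm_le_of_norm_deriv_right_le_deriv_boundary
      (B' := fun u => k * E u ^ (k - 1) * (κ * E u))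
      (fun u hu => (hd u hu).continuousAt.continuousWithinAt)
      (fun u hu => (hd u ⟨hu.1, hu.2.le⟩).hasDerivWithinAt) ?_
      (fun u => (hEd u).pow k) ?_
    · rcases Nat.eq_zero_or_pos k with rfl | hk
      · simp [hm0]
      · simpa [hm0, hk.ne'] using pow_nonneg hB0.le k
    · intro u hu
      have hu' : u ∈ Set.Icc (0 : ℝ) 1 := ⟨hu.1, hu.2.le⟩
      rw [norm_mul, norm_neg, Finset.sum_range_succ']
      have h1 : ∀ i ∈ Finset.range k,
          ‖((i + 1 : ℕ) : ℂ) * a (k + 1 - (i + 1)) (u * t) * m (i + 1) (u * t)‖ ≤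
            k * E u ^ k * (F / B) ^ (k - i) := by
        intro i hi
        have hik := Finset.mem_range.1 hi
        have e1 : k + 1 - (i + 1) = k - i := by omega
        have h2 : ‖a (k - i) (u * t)‖ ≤ (F / B * E u) ^ (k - i) :=
          (ha _ (by omega) u hu').trans (pow_le_pow_left₀ (by positivity) (hFE u hu') _)
        have h3 := ih i hik u hu'
        have h4 : (((i + 1 : ℕ) : ℝ)) ≤ k := by exact_mod_cast hik
        rw [norm_mul, norm_mul, Complex.norm_natCast, e1]
        calc ((i + 1 : ℕ) : ℝ) * ‖a (k - i) (u * t)‖ * ‖m (i + 1) (u * t)‖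
            ≤ k * (F / B * E u) ^ (k - i) * E u ^ i := by
              have := (hE0 u).le
              gcongr
          _ = k * E u ^ k * (F / B) ^ (k - i) := by
              have : E u ^ k = E u ^ (k - i) * E u ^ i := by
                rw [← pow_add, Nat.sub_add_cancel hik.le]
              rw [mul_pow, this]
              ring
      have h5 : ‖(∑ i ∈ Finset.range k,
          ((i + 1 : ℕ) : ℂ) * a (k + 1 - (i + 1)) (u * t) * m (i + 1) (u * t)) +
            ((0 : ℕ) : ℂ) * a (k + 1 - 0) (u * t) * m 0 (u * t)‖ ≤ k * E u ^ k * ε := by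
        rw [Nat.cast_zero, zero_mul, zero_mul, add_zero]
        refine (norm_sum_le_of_le _ h1).trans ?_
        rw [← Finset.mul_sum]
        have := (hE0 u).le
        gcongr
        exact sum_range_pow_sub_le hε hq k
      refine (mul_le_mul_of_nonneg_right h5 (norm_nonneg t)).trans ?_
      have h6 : (k : ℝ) * E u ^ (k - 1) * (κ * E u) = k * E u ^ k * κ := by
        rcases Nat.eq_zero_or_pos k with rfl | hk
        · simp
        · obtain ⟨l, rfl⟩ := Nat.exists_eq_add_of_le' hk
          rw [Nat.add_sub_cancel, pow_succ]; ring
      rw [h6, mul_assoc]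
      have := (hE0 u).le
      gcongr
      rw [hκ]; linarith

lemma norm_exp_ofReal_mul (l : ℝ) (t : ℂ) : ‖Complex.exp (l * t)‖ = Real.exp (l * t.re) := by
  rw [Complex.norm_exp]; simp

/-- The coefficients `h n` of a first integral `∑ h n (t) * y ^ n` of the foliation on the universal
cover `x = x₀ * exp t` of the punctured disc, normalized by the condition that it is `y` for
`t = 0`. The hypothesis `lam ≤ 0` gives the bounds: it makes `h n / h 1` subexponential as
`re t → -∞`. -/
theorem exists_firstIntegral_coeffs {lam r : ℝ} (hlam : lam ≤ 0) {f : ℂ × ℂ → ℂ}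
    (hf : AnalyticOnNhd ℂ f (axisDisc r)) {x₀ : ℂ} {a : ℝ}
    (ha : ∀ t : ℂ, t.re < a → ‖x₀ * Complex.exp t‖ < r) (ha0 : 0 < a) :
    ∃ h : ℕ → ℂ → ℂ,
      (∀ n, ∀ t : ℂ, t.re < a → HasDerivAt (h n) (-(n * lam * h n t) -
        ∑ j ∈ Finset.range n, (j : ℂ) * fiberCoeff f (n - j) (x₀ * Complex.exp t) * h j t) t) ∧
      (∀ n, h n 0 = if n = 1 then 1 else 0) ∧
      (∀ t : ℂ, t.re < a → h 0 t = 0 ∧ h 1 t = Complex.exp (-lam * t)) ∧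
      ∀ b < a, ∀ ε > 0, ∃ B : ℝ, 1 ≤ B ∧ ∀ t : ℂ, t.re ≤ b → ∀ k,
        ‖h (k + 1) t‖ ≤ ‖Complex.exp (-lam * t)‖ * (B * Real.exp (ε * ‖t‖)) ^ k := by
  set D : Set ℂ := {t | t.re < a} with hDdef
  have hD : Convex ℝ D := convex_halfSpace_re_lt a
  have hDo : IsOpen D := isOpen_lt Complex.continuous_re continuous_const
  have h0D : (0 : ℂ) ∈ D := by simpa [hDdef] using ha0
  -- the change of variable `z = exp (-lam * t) * y` removes the linear terms from the system
  set α : ℕ → ℂ → ℂ := fun n t =>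
    fiberCoeff f n (x₀ * Complex.exp t) * Complex.exp (n * lam * t) with hα
  have hαd : ∀ n, DifferentiableOn ℂ (α n) D := by
    intro n t ht
    have h1 : AnalyticAt ℂ (fiberCoeff f n) (x₀ * Complex.exp t) :=
      analyticAt_fiberCoeff (hf _ ⟨ha t ht, rfl⟩) n
    have h2 : DifferentiableAt ℂ (fun t => fiberCoeff f n (x₀ * Complex.exp t)) t :=
      DifferentiableAt.comp (g := fiberCoeff f n) t h1.differentiableAt (by fun_prop)
    exact (h2.mul (by fun_prop)).differentiableWithinAt
  obtain ⟨m, hm, hm0⟩ := exists_quadratures hD hDo hαd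
  -- the first two equations have no right-hand side
  have hconst : ∀ n ≤ 1, ∀ t ∈ D, m n t = m n 0 := by
    intro n hn t ht
    refine hD.is_const_of_fderivWithin_eq_zero (𝕜 := ℂ) (f := m n)
      (fun s hs => (hm n s hs).differentiableAt.differentiableWithinAt) (fun s hs => ?_) ht h0D
    rw [fderivWithin_of_isOpen hDo hs]
    have h1 : HasDerivAt (m n) 0 s := by
      refine (hm n s hs).congr_deriv ?_
      interval_cases n <;> simp
    ext; simp [h1.deriv]
  refine ⟨fun n t => m n t * Complex.exp (-(n * lam * t)), ?_, ?_, ?_, ?_⟩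
  · intro n t ht
    have h1 : HasDerivAt (fun t : ℂ => Complex.exp (-(n * lam * t)))
        (Complex.exp (-(n * lam * t)) * -(n * lam)) t := by
      have := (((hasDerivAt_id t).const_mul ((n : ℂ) * lam)).neg).cexp
      simpa using this
    refine ((hm n t ht).mul h1).congr_deriv ?_
    have h2 : (∑ j ∈ Finset.range n, (j : ℂ) * α (n - j) t * m j t) *
        Complex.exp (-(n * lam * t)) = ∑ j ∈ Finset.range n,
          (j : ℂ) * fiberCoeff f (n - j) (x₀ * Complex.exp t) *
            (m j t * Complex.exp (-(j * lam * t))) := by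
      rw [Finset.sum_mul]
      refine Finset.sum_congr rfl fun j hj => ?_
      have hjn := (Finset.mem_range.1 hj).le
      have h3 : Complex.exp (-(j * lam * t)) =
          Complex.exp (((n - j : ℕ) : ℂ) * lam * t) * Complex.exp (-(n * lam * t)) := by
        rw [← Complex.exp_add, Nat.cast_sub hjn]; ring_nf
      rw [h3, hα]
      ring
    rw [neg_mul, h2]
    ring
  · intro n
    simp [hm0]
  · intro t ht
    simp only [hconst 0 (by norm_num) t ht, hconst 1 le_rfl t ht, hm0]
    simp
  · intro b hb ε hε
    set b' := max b 0
    have hb'a : b' < a := max_lt hb ha0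
    have hρ : ‖x₀ * Complex.exp (b' : ℂ)‖ < r := ha _ (by simpa using hb'a)
    obtain ⟨F, hF, hFb⟩ := exists_fiberCoeff_bound hf hρ
    set B₀ := F * (1 + ε) / ε with hB₀
    have hB₀0 : 0 < B₀ := by positivity
    refine ⟨max 1 (B₀ * Real.exp (-lam * b')), le_max_left _ _, fun t ht k => ?_⟩
    have hre : ∀ u ∈ Set.Icc (0 : ℝ) 1, ((u : ℂ) * t).re ≤ b' := by
      intro u hu
      have h1 : ((u : ℂ) * t).re = u * t.re := by simp
      rw [h1]
      have h2 : t.re ≤ b' := ht.trans (le_max_left _ _)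
      have h3 : 0 ≤ b' := le_max_right _ _
      nlinarith [hu.1, hu.2]
    -- for `re t ≤ 0`, `P = lam * t.re` compensates exactly the factor `exp (-k * lam * t)` in `h`
    set P := max 0 (lam * t.re) with hP
    have hbound := norm_quadratures_le (a := α) (m := m) (t := t) (F := F) (P := P) (ε := ε)
      (fun n u hu => hm n _ ((hre u hu).trans_lt hb'a)) hm0 hF hε ?_ (le_max_left _ _) k 1
      ⟨zero_le_one, le_rfl⟩
    · rw [Complex.ofReal_one, one_mul, mul_one, ← hB₀] at hbound
      have e1 : Complex.exp (-(((k + 1 : ℕ) : ℂ) * lam * t)) =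
          Complex.exp (-lam * t) * Complex.exp ((-lam : ℝ) * t) ^ k := by
        rw [← Complex.exp_nat_mul, ← Complex.exp_add]; push_cast; ring_nf
      rw [norm_mul, e1, norm_mul, norm_pow, norm_exp_ofReal_mul]
      calc ‖m (k + 1) t‖ * (‖Complex.exp (-lam * t)‖ * Real.exp (-lam * t.re) ^ k)
          ≤ (B₀ * Real.exp (ε * ‖t‖ + P)) ^ k *
              (‖Complex.exp (-lam * t)‖ * Real.exp (-lam * t.re) ^ k) := by gcongr
        _ = ‖Complex.exp (-lam * t)‖ *
              (B₀ * Real.exp (P - lam * t.re) * Real.exp (ε * ‖t‖)) ^ k := by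
            have : Real.exp (P - lam * t.re) = Real.exp P * Real.exp (-lam * t.re) := by
              rw [← Real.exp_add]; ring_nf
            rw [this, Real.exp_add]
            ring_nf
        _ ≤ _ := by
            have h1 : P - lam * t.re ≤ -lam * b' := by
              have h2 : t.re ≤ b' := ht.trans (le_max_left _ _)
              have h3 : 0 ≤ b' := le_max_right _ _
              rcases max_cases 0 (lam * t.re) with ⟨h, _⟩ | ⟨h, _⟩ <;> rw [hP, h] <;> nlinarith
            have h4 : B₀ * Real.exp (P - lam * t.re) ≤ max 1 (B₀ * Real.exp (-lam * b')) :=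
              (by gcongr : _ ≤ B₀ * Real.exp (-lam * b')).trans (le_max_right _ _)
            gcongr
    · intro n hn u hu
      have h1 : ‖x₀ * Complex.exp (u * t)‖ ≤ ‖x₀ * Complex.exp (b' : ℂ)‖ := by
        rw [norm_mul, norm_mul, Complex.norm_exp, Complex.norm_exp, Complex.ofReal_re]
        have := hre u hu
        gcongr
      have h2 : Complex.exp (n * lam * (u * t)) = Complex.exp ((lam : ℝ) * (u * t)) ^ n := by
        rw [← Complex.exp_nat_mul]; ring_nf
      rw [hα, norm_mul, h2, norm_pow, norm_exp_ofReal_mul, mul_pow]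
      have h3 : lam * ((u : ℂ) * t).re ≤ P * u := by
        have h4 : ((u : ℂ) * t).re = u * t.re := by simp
        rw [h4]
        have := mul_le_mul_of_nonneg_right (le_max_right 0 (lam * t.re)) hu.1
        rw [hP]; linarith
      have := (hFb _ h1).1 n hn
      gcongr

/-! ### A first integral on the universal cover of the punctured disc -/

/-- `H (t, y)` is a first integral, on a neighbourhood of `{re t < a} × {0}`, of the pull-back of
the foliation by the covering `x = x₀ * exp t`. It is normalized by `H (0, y) = y`, and on the fibre
over `t` it is close to its linear part `exp (-lam * t) * y` on a disc of radius
`B⁻¹ * exp (-ε * ‖t‖)`: the domain shrinks slower than every power of `x` as `x → 0`. -/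
structure IsCoverFirstIntegral (lam a : ℝ) (f : ℂ × ℂ → ℂ) (x₀ : ℂ) (H : ℂ × ℂ → ℂ) : Prop where
  analyticAt : ∀ t : ℂ, t.re < a → AnalyticAt ℂ H (t, 0)
  zero : ∀ t : ℂ, t.re < a → H (t, 0) = 0
  partialY_eq : ∀ t : ℂ, t.re < a → partialY H (t, 0) = Complex.exp (-lam * t)
  init : ∀ᶠ y in 𝓝 (0 : ℂ), H (0, y) = y
  pde : ∀ t : ℂ, t.re < a → ∀ᶠ p in 𝓝 (t, (0 : ℂ)),
    partialX H p + (lam + f (x₀ * Complex.exp p.1, p.2)) * p.2 * partialY H p = 0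
  bound : ∀ b < a, ∀ ε > 0, ∃ B : ℝ, 1 ≤ B ∧ ∀ t : ℂ, t.re ≤ b → ∀ y : ℂ,
    B * Real.exp (ε * ‖t‖) * ‖y‖ < 1 → DifferentiableAt ℂ (fun y => H (t, y)) y ∧
      ‖deriv (fun y => H (t, y)) y - Complex.exp (-lam * t)‖ ≤ ‖Complex.exp (-lam * t)‖ / 2

/-- A power series tangent to `μ * y` with geometrically bounded coefficients is close to `μ * y` in
the `C¹` sense on a disc of comparable radius. -/
lemma deriv_tsum_sub_le {h : ℕ → ℂ} {μ : ℂ} {A : ℝ} (hA : 0 < A) (h0 : h 0 = 0) (h1 : h 1 = μ)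
    (hb : ∀ k, ‖h (k + 1)‖ ≤ ‖μ‖ * A ^ k) {y : ℂ} (hy : 16 * A * ‖y‖ < 1) :
    DifferentiableAt ℂ (fun y => ∑' n, h n * y ^ n) y ∧
      ‖deriv (fun y => ∑' n, h n * y ^ n) y - μ‖ ≤ ‖μ‖ / 2 := by
  set s : ℝ := 1 / (16 * A) with hs
  have hs0 : 0 < s := by positivity
  have hys : ‖y‖ < s := by rw [hs, lt_div_iff₀ (by positivity)]; linarith
  have hAs : A * s = 1 / 16 := by rw [hs]; field_simp
  -- on the disc of radius `4 * s` the series is dominated by a geometric one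
  have hterm : ∀ z ∈ Metric.ball (0 : ℂ) (4 * s), ∀ k, ‖h (k + 1) * z ^ (k + 1)‖ ≤
      ‖μ‖ * ‖z‖ * (1 / 4) ^ k := by
    intro z hz k
    have hz' : ‖z‖ < 4 * s := by simpa using hz
    rw [norm_mul, norm_pow]
    calc ‖h (k + 1)‖ * ‖z‖ ^ (k + 1) ≤ ‖μ‖ * A ^ k * ‖z‖ ^ (k + 1) := by gcongr; exact hb k
      _ = ‖μ‖ * ‖z‖ * (A * ‖z‖) ^ k := by ring
      _ ≤ ‖μ‖ * ‖z‖ * (1 / 4) ^ k := by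
        have : A * ‖z‖ ≤ 1 / 4 := by nlinarith
        gcongr
  have hsum4 : Summable fun k : ℕ => (1 / 4 : ℝ) ^ k :=
    summable_geometric_of_lt_one (by norm_num) (by norm_num)
  have hd : DifferentiableOn ℂ (fun y => ∑' n, h n * y ^ n) (Metric.ball 0 (4 * s)) := by
    refine Complex.differentiableOn_tsum_of_summable_norm
      (u := fun n => ‖μ‖ * (4 * s) * (1 / 4) ^ (n - 1)) ?_ (fun n => by fun_prop)
      Metric.isOpen_ball ?_
    · rw [← summable_nat_add_iff 1]
      simpa using hsum4.mul_left (‖μ‖ * (4 * s))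
    · intro n z hz
      have hz' : ‖z‖ < 4 * s := by simpa using hz
      rcases n with _ | k
      · simp only [h0, zero_mul, norm_zero]; positivity
      · refine (hterm z hz k).trans ?_
        rw [Nat.add_sub_cancel]
        gcongr
  have herr : ∀ z ∈ Metric.ball (0 : ℂ) (4 * s),
      ‖(∑' n, h n * z ^ n) - μ * z‖ ≤ 2 * ‖μ‖ * A * ‖z‖ ^ 2 := by
    intro z hz
    have hz' : ‖z‖ < 4 * s := by simpa using hz
    have hAz : A * ‖z‖ ≤ 1 / 4 := by nlinarith
    have hsz : Summable fun n => h n * z ^ n := by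
      rw [← summable_nat_add_iff 1]
      exact Summable.of_norm_bounded (hsum4.mul_left (‖μ‖ * ‖z‖)) (hterm z hz)
    have h2 : (∑' n, h n * z ^ n) - μ * z = ∑' k, h (k + 2) * z ^ (k + 2) := by
      rw [← hsz.sum_add_tsum_nat_add 2]
      simp [Finset.sum_range_succ, h0, h1]
    have h3 : ∀ k, ‖h (k + 2) * z ^ (k + 2)‖ ≤ ‖μ‖ * A * ‖z‖ ^ 2 * (1 / 4) ^ k := by
      intro k
      rw [norm_mul, norm_pow]
      calc ‖h (k + 2)‖ * ‖z‖ ^ (k + 2) ≤ ‖μ‖ * A ^ (k + 1) * ‖z‖ ^ (k + 2) := by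
            gcongr; exact hb (k + 1)
        _ = ‖μ‖ * A * ‖z‖ ^ 2 * (A * ‖z‖) ^ k := by ring
        _ ≤ _ := by gcongr
    rw [h2]
    refine (tsum_of_norm_bounded ((hasSum_geometric_of_lt_one (by norm_num)
      (by norm_num)).mul_left (‖μ‖ * A * ‖z‖ ^ 2)) h3).trans ?_
    have : (0 : ℝ) ≤ ‖μ‖ * A * ‖z‖ ^ 2 := by positivity
    rw [show ((1 : ℝ) - 1 / 4)⁻¹ = 4 / 3 by norm_num]
    linarith
  have hy4 : Metric.closedBall y s ⊆ Metric.ball (0 : ℂ) (2 * s) := by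
    intro z hz
    have h1 : ‖z - y‖ ≤ s := by simpa [dist_eq_norm] using hz
    have h2 : ‖z‖ < 2 * s := by
      calc ‖z‖ = ‖(z - y) + y‖ := by ring_nf
        _ ≤ ‖z - y‖ + ‖y‖ := norm_add_le _ _
        _ < 2 * s := by linarith
    simpa using h2
  have h24 : Metric.ball (0 : ℂ) (2 * s) ⊆ Metric.ball 0 (4 * s) :=
    Metric.ball_subset_ball (by linarith)
  have hdy : DifferentiableAt ℂ (fun y => ∑' n, h n * y ^ n) y :=
    hd.differentiableAt (Metric.isOpen_ball.mem_nhds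
      (h24 (hy4 (Metric.mem_closedBall_self hs0.le))))
  refine ⟨hdy, ?_⟩
  have hdE : DifferentiableOn ℂ (fun z => (∑' n, h n * z ^ n) - μ * z) (Metric.closedBall y s) :=
    (hd.mono (hy4.trans h24)).sub (by fun_prop)
  have hder : deriv (fun z => (∑' n, h n * z ^ n) - μ * z) y =
      deriv (fun y => ∑' n, h n * y ^ n) y - μ := by
    have := hdy.hasDerivAt.sub ((hasDerivAt_id y).const_mul μ)
    rw [mul_one] at this
    exact this.deriv
  rw [← hder]
  have hC := Complex.norm_deriv_le_of_forall_mem_sphere_norm_le (C := ‖μ‖ / 2 * s) hs0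
    (hdE.diffContOnCl_ball subset_rfl) (fun z hz => ?_)
  · refine hC.trans (le_of_eq ?_)
    field_simp
  · have hz2 := hy4 (Metric.sphere_subset_closedBall hz)
    refine (herr z (h24 hz2)).trans ?_
    have hz' : ‖z‖ ≤ 2 * s := by simpa using (Metric.mem_ball.1 hz2).le
    calc 2 * ‖μ‖ * A * ‖z‖ ^ 2 ≤ 2 * ‖μ‖ * A * (2 * s) ^ 2 := by gcongr
      _ = ‖μ‖ * (8 * (A * s) * s) := by ring
      _ = ‖μ‖ / 2 * s := by rw [hAs]; ring

lemma deriv_tsum_mul_pow_zero {h : ℕ → ℂ} {C A : ℝ} (hC : 0 ≤ C) (hA : 0 < A)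
    (hb : ∀ n, ‖h n‖ ≤ C * A ^ n) : deriv (fun y => ∑' n, h n * y ^ n) 0 = h 1 := by
  have h1 := Complex.hasSum_deriv_of_summable_norm (F := fun n y => h n * y ^ n)
    (U := Metric.ball 0 (1 / (2 * A))) (z := 0) (u := fun n => C * (1 / 2) ^ n)
    ((summable_geometric_of_lt_one (by norm_num) (by norm_num)).mul_left C)
    (fun n => by fun_prop) Metric.isOpen_ball (fun n y hy => by
      have hy' : ‖y‖ < 1 / (2 * A) := by simpa using hy
      have hAy : A * ‖y‖ ≤ 1 / 2 := by
        rw [lt_div_iff₀ (by positivity)] at hy'; linarith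
      rw [norm_mul, norm_pow]
      calc ‖h n‖ * ‖y‖ ^ n ≤ C * A ^ n * ‖y‖ ^ n := by gcongr; exact hb n
        _ = C * (A * ‖y‖) ^ n := by ring
        _ ≤ C * (1 / 2) ^ n := by gcongr) (Metric.mem_ball_self (by positivity))
  refine h1.unique ?_
  have h3 : (fun n : ℕ => deriv (fun y : ℂ => h n * y ^ n) 0) =
      fun n : ℕ => if n = 1 then h 1 else 0 := by
    ext n
    rw [deriv_const_mul_field, deriv_pow_field]
    rcases n with _ | _ | n <;> simp
  rw [h3]
  exact hasSum_ite_eq 1 (h 1)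

lemma isOpen_re_lt (a : ℝ) : IsOpen {t : ℂ | t.re < a} :=
  isOpen_lt Complex.continuous_re continuous_const

/-- The power series with the coefficients of `exists_firstIntegral_coeffs` is a first integral:
the system for the coefficients is the coefficient of `y ^ n` in the differential equation, as a
Cauchy product shows. -/
theorem exists_coverFirstIntegral {lam r : ℝ} (hlam : lam ≤ 0) {f : ℂ × ℂ → ℂ}
    (hf : AnalyticOnNhd ℂ f (axisDisc r)) (hf0 : ∀ p ∈ axisDisc r, f p = 0) {x₀ : ℂ} {a : ℝ}
    (ha : ∀ t : ℂ, t.re < a → ‖x₀ * Complex.exp t‖ < r) (ha0 : 0 < a) :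
    ∃ H : ℂ × ℂ → ℂ, IsCoverFirstIntegral lam a f x₀ H := by
  obtain ⟨h, hd, hi, h01, hb⟩ := exists_firstIntegral_coeffs hlam hf ha ha0
  -- locally uniform geometric bounds
  have hloc : ∀ t : ℂ, t.re < a → ∃ (W : Set ℂ) (C A : ℝ), IsOpen W ∧ t ∈ W ∧ W ⊆ {t | t.re < a} ∧
      0 < C ∧ 0 < A ∧ ∀ n, ∀ s ∈ W, ‖h n s‖ ≤ C * A ^ n := by
    intro t ht
    obtain ⟨b, htb, hba⟩ := exists_between ht
    obtain ⟨B, hB, hBh⟩ := hb b hba 1 one_pos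
    refine ⟨{s | s.re < b} ∩ Metric.ball t 1, Real.exp (-lam * b), B * Real.exp (‖t‖ + 1),
      (isOpen_re_lt b).inter Metric.isOpen_ball, ⟨htb, Metric.mem_ball_self one_pos⟩,
      fun s hs => hs.1.trans hba, Real.exp_pos _, by positivity, fun n s hs => ?_⟩
    have hsb : s.re < b := hs.1
    rcases n with _ | k
    · rw [(h01 s (hsb.trans hba)).1, norm_zero]; positivity
    · have h1 : ‖s‖ ≤ ‖t‖ + 1 := by
        have h2 : ‖s - t‖ < 1 := by simpa [dist_eq_norm] using hs.2
        calc ‖s‖ = ‖t + (s - t)‖ := by ring_nf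
          _ ≤ ‖t‖ + ‖s - t‖ := norm_add_le _ _
          _ ≤ ‖t‖ + 1 := by linarith
      have h3 : ‖Complex.exp (-lam * s)‖ ≤ Real.exp (-lam * b) := by
        have := norm_exp_ofReal_mul (-lam) s
        rw [Complex.ofReal_neg] at this
        rw [this]
        apply Real.exp_le_exp.2
        nlinarith
      have h4 : 1 ≤ B * Real.exp (‖t‖ + 1) :=
        one_le_mul_of_one_le_of_one_le hB (Real.one_le_exp (by positivity))
      refine (hBh s hsb.le k).trans ?_
      rw [one_mul]
      calc ‖Complex.exp (-lam * s)‖ * (B * Real.exp ‖s‖) ^ k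
          ≤ Real.exp (-lam * b) * (B * Real.exp (‖t‖ + 1)) ^ k := by gcongr
        _ ≤ Real.exp (-lam * b) * (B * Real.exp (‖t‖ + 1)) ^ (k + 1) := by
          gcongr
          exact Nat.le_succ k
  have hdiff : ∀ n, ∀ t : ℂ, t.re < a → DifferentiableAt ℂ (h n) t :=
    fun n t ht => (hd n t ht).differentiableAt
  set H : ℂ × ℂ → ℂ := fun p => ∑' n, h n p.1 * p.2 ^ n with hH
  have hHan : ∀ t : ℂ, t.re < a → AnalyticAt ℂ H (t, 0) := by
    intro t ht
    obtain ⟨W, C, A, hWo, htW, hWa, hC, hA, hbd⟩ := hloc t ht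
    exact analyticAt_tsum_mul_pow hWo
      (fun n s hs => (hdiff n s (hWa hs)).differentiableWithinAt) hbd hA htW (by simp)
  have hB' : ∀ b < a, ∀ ε > 0, ∃ B : ℝ, 1 ≤ B ∧ ∀ t : ℂ, t.re ≤ b → ∀ y : ℂ,
      B * Real.exp (ε * ‖t‖) * ‖y‖ < 1 → DifferentiableAt ℂ (fun y => H (t, y)) y ∧
      ‖deriv (fun y => H (t, y)) y - Complex.exp (-lam * t)‖ ≤
        ‖Complex.exp (-lam * t)‖ / 2 := by
    intro b hba ε hε
    obtain ⟨B, hB, hBh⟩ := hb b hba ε hε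
    refine ⟨16 * B, by linarith, fun t ht y hy => ?_⟩
    have hta := ht.trans_lt hba
    exact deriv_tsum_sub_le (h := fun n => h n t) (A := B * Real.exp (ε * ‖t‖)) (by positivity)
      (h01 t hta).1 (h01 t hta).2 (hBh t ht) (by rw [← mul_assoc]; exact hy)
  have hfiber : ∀ t : ℂ, t.re < a → partialY H (t, 0) = Complex.exp (-lam * t) := by
    intro t ht
    obtain ⟨W, C, A, hWo, htW, hWa, hC, hA, hbd⟩ := hloc t ht
    rw [← (h01 t ht).2, ← deriv_tsum_mul_pow_zero hC.le hA fun n => hbd n t htW]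
    exact (hasDerivAt_partialY (hHan t ht).differentiableAt).deriv.symm
  refine ⟨H, hHan, fun t ht => ?_, hfiber, ?_, ?_, hB'⟩
  · simp only [hH]
    rw [tsum_eq_single 0]
    · simp [(h01 t ht).1]
    · intro n hn; simp [hn]
  · refine Eventually.of_forall fun y => ?_
    simp only [hH, hi]
    rw [tsum_eq_single 1]
    · simp
    · intro n hn; simp [hn]
  · intro t ht
    obtain ⟨W, C, A, hWo, htW, hWa, hC, hA, hbd⟩ := hloc t ht
    obtain ⟨b, htb, hba⟩ := exists_between ht
    have hρ : ‖x₀ * Complex.exp (b : ℂ)‖ < r := ha _ (by simpa using hba)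
    obtain ⟨F, hF, hFb⟩ := exists_fiberCoeff_bound hf hρ
    have hAF : 0 < 1 / (2 * max A F) := by positivity
    have hWb : IsOpen (W ∩ {s | s.re < b}) := hWo.inter (isOpen_re_lt b)
    filter_upwards [(hWb.prod Metric.isOpen_ball).mem_nhds
      (Set.mk_mem_prod (⟨htW, htb⟩ : t ∈ W ∩ {s | s.re < b}) (Metric.mem_ball_self hAF)),
      (hHan t ht).eventually_analyticAt] with p hp hpan
    obtain ⟨s, y⟩ := p
    obtain ⟨⟨hsW, hsb⟩, hy⟩ := hp
    have hsa : s.re < a := hWa hsW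
    have hy0 : y ∈ Metric.ball (0 : ℂ) (1 / (2 * max A F)) := hy
    have hmax : ∀ z ∈ Metric.ball (0 : ℂ) (1 / (2 * max A F)), max A F * ‖z‖ < 1 / 2 := by
      intro z hz
      have hz' : ‖z‖ < 1 / (2 * max A F) := by simpa using hz
      rw [lt_div_iff₀ (by positivity)] at hz'
      linarith
    have hle : ∀ z ∈ Metric.ball (0 : ℂ) (1 / (2 * max A F)), ∀ n, ∀ s ∈ W,
        ‖h n s * z ^ n‖ ≤ C * (1 / 2) ^ n := by
      intro z hz n s hs
      have hAz : A * ‖z‖ ≤ 1 / 2 :=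
        (mul_le_mul_of_nonneg_right (le_max_left A F) (norm_nonneg z)).trans (hmax z hz).le
      rw [norm_mul, norm_pow]
      calc ‖h n s‖ * ‖z‖ ^ n ≤ C * A ^ n * ‖z‖ ^ n := by gcongr; exact hbd n s hs
        _ = C * (A * ‖z‖) ^ n := by ring
        _ ≤ C * (1 / 2) ^ n := by gcongr
    have hgeo : Summable fun n : ℕ => C * (1 / 2 : ℝ) ^ n :=
      (summable_geometric_of_lt_one (by norm_num) (by norm_num)).mul_left C
    have hY := Complex.hasSum_deriv_of_summable_norm (F := fun n y => h n s * y ^ n)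
      (U := Metric.ball 0 (1 / (2 * max A F))) hgeo (fun n => by fun_prop) Metric.isOpen_ball
      (fun n z hz => hle z hz n s hsW) hy0
    have hX := Complex.hasSum_deriv_of_summable_norm (F := fun n s => h n s * y ^ n)
      (U := W) hgeo (fun n s hs => ((hdiff n s (hWa hs)).mul_const _).differentiableWithinAt) hWo
      (fun n s hs => hle y hy0 n s hs) hsW
    have eX : deriv (fun s => ∑' n, h n s * y ^ n) s = partialX H (s, y) :=
      (hasDerivAt_partialX hpan.differentiableAt).deriv
    have eY : deriv (fun y => ∑' n, h n s * y ^ n) y = partialY H (s, y) :=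
      (hasDerivAt_partialY hpan.differentiableAt).deriv
    rw [eX] at hX
    rw [eY] at hY
    -- the Euler derivative `y ∂H/∂y`
    have hYy : HasSum (fun n : ℕ => (n : ℂ) * h n s * y ^ n) (y * partialY H (s, y)) := by
      have e : (fun n : ℕ => (n : ℂ) * h n s * y ^ n) =
          fun n : ℕ => y * deriv (fun y => h n s * y ^ n) y := by
        ext n
        rw [deriv_const_mul_field, deriv_pow_field]
        rcases n with _ | n
        · simp
        · rw [Nat.add_sub_cancel, pow_succ]; ring
      rw [e]
      exact hY.mul_left y
    have hxρ : ‖x₀ * Complex.exp s‖ ≤ ‖x₀ * Complex.exp (b : ℂ)‖ := by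
      rw [norm_mul, norm_mul, Complex.norm_exp, Complex.norm_exp, Complex.ofReal_re]
      have : s.re ≤ b := le_of_lt hsb
      gcongr
    have hFy : F * ‖y‖ < 1 := by
      have := (mul_le_mul_of_nonneg_right (le_max_right A F) (norm_nonneg y)).trans_lt (hmax y hy0)
      linarith
    have hf' := (hFb _ hxρ).2 y hFy
    have hprod := hasSum_sum_range_mul_of_summable_norm hYy.summable.norm hf'.summable.norm
    rw [hYy.tsum_eq, hf'.tsum_eq] at hprod
    have hfc0 : fiberCoeff f 0 (x₀ * Complex.exp s) = 0 := by
      rw [fiberCoeff_zero]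
      exact hf0 _ ⟨ha s hsa, rfl⟩
    have hX' := (hYy.mul_left (lam : ℂ)).add hprod
    have e : (fun n : ℕ => deriv (fun s => h n s * y ^ n) s) = fun n : ℕ =>
        -((lam : ℂ) * ((n : ℂ) * h n s * y ^ n) + ∑ k ∈ Finset.range (n + 1),
          (k : ℂ) * h k s * y ^ k *
            (fiberCoeff f (n - k) (x₀ * Complex.exp s) * y ^ (n - k))) := by
      ext n
      rw [((hd n s hsa).mul_const (y ^ n)).deriv, Finset.sum_range_succ, Nat.sub_self, hfc0,
        zero_mul, mul_zero, add_zero, sub_mul, Finset.sum_mul]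
      have e1 : ∑ k ∈ Finset.range n, (k : ℂ) * h k s * y ^ k *
          (fiberCoeff f (n - k) (x₀ * Complex.exp s) * y ^ (n - k)) =
          ∑ k ∈ Finset.range n, (k : ℂ) * fiberCoeff f (n - k) (x₀ * Complex.exp s) * h k s *
            y ^ n := by
        refine Finset.sum_congr rfl fun k hk => ?_
        have : y ^ n = y ^ k * y ^ (n - k) := by
          rw [← pow_add, Nat.add_sub_cancel' (Finset.mem_range.1 hk).le]
        rw [this]; ring
      rw [e1]; ring
    rw [e] at hX
    have := hX.unique hX'.neg
    change partialX H (s, y) + (lam + f (x₀ * Complex.exp s, y)) * y * partialY H (s, y) = 0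
    rw [this]
    ring

/-! ### The monodromy of first integrals, read on the universal cover -/

/-- Identity theorem for germs at two points of a ball. -/
lemma eventuallyEq_of_analyticOnNhd_ball {V : Type*} [NormedAddCommGroup V] [NormedSpace ℂ V]
    {F G : ℂ × ℂ → V} {c p q : ℂ × ℂ} {δ : ℝ}
    (hF : AnalyticOnNhd ℂ F (Metric.ball c δ)) (hG : AnalyticOnNhd ℂ G (Metric.ball c δ))
    (hp : p ∈ Metric.ball c δ) (hq : q ∈ Metric.ball c δ) (h : F =ᶠ[𝓝 p] G) : F =ᶠ[𝓝 q] G := by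
  have h1 := hF.eqOn_of_preconnected_of_eventuallyEq hG (convex_ball c δ).isPreconnected hp h
  exact h1.eventuallyEq_of_mem (Metric.isOpen_ball.mem_nhds hq)

/-- The covering of `{x ≠ 0}` by `ℂ × ℂ` given by `x = x₀ * exp t`. -/
noncomputable def coverMap (x₀ : ℂ) (p : ℂ × ℂ) : ℂ × ℂ := (x₀ * Complex.exp p.1, p.2)

lemma analyticAt_coverMap (x₀ : ℂ) (p : ℂ × ℂ) : AnalyticAt ℂ (coverMap x₀) p := by
  unfold coverMap
  exact (analyticAt_const.mul analyticAt_fst.cexp).prod analyticAt_snd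

lemma tendsto_coverMap (x₀ : ℂ) (p : ℂ × ℂ) :
    Tendsto (coverMap x₀) (𝓝 p) (𝓝 (coverMap x₀ p)) :=
  (analyticAt_coverMap x₀ p).continuousAt

/-- The condition `dh ∧ ω = 0`, as a linear partial differential equation for `h`. -/
lemma WedgeZero.pde {lam : ℂ} {f h : ℂ × ℂ → ℂ} {q : ℂ × ℂ}
    (hw : WedgeZero (fderiv ℂ h q) (form lam f q)) :
    q.1 * partialX h q + (lam + f q) * q.2 * partialY h q = 0 := by
  have := hw (1, 0) (0, 1)
  simp only [form, fderiv_apply_eq, _root_.sub_apply, _root_.smul_apply,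
    ContinuousLinearMap.coe_fst', ContinuousLinearMap.coe_snd', smul_eq_mul] at this
  linear_combination this

lemma partialY_ne_zero_of_minimal {lam : ℂ} {f h : ℂ × ℂ → ℂ} {x₀ : ℂ} (hx₀ : x₀ ≠ 0)
    (hh : IsMinimalFirstIntegral lam f h (x₀, 0)) : partialY h (x₀, 0) ≠ 0 := by
  intro hy
  have h1 := hh.2.2.2.self_of_nhds.pde
  simp only [mul_zero, zero_mul, add_zero, mul_eq_zero, hx₀, false_or] at h1
  refine hh.2.2.1 ?_
  ext <;> simp [fderiv_apply_eq, h1, hy]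

/-- A first integral which is analytic near `(x₀, 0)` is determined by its restriction to the
transversal `x = x₀`. -/
lemma firstIntegral_eq_comp {lam a : ℝ} {f h H : ℂ × ℂ → ℂ} {x₀ : ℂ} (ha : 0 < a)
    (hH : IsCoverFirstIntegral lam a f x₀ H) (hh : AnalyticAt ℂ h (x₀, 0))
    (hw : ∀ᶠ q in 𝓝 (x₀, (0 : ℂ)), WedgeZero (fderiv ℂ h q) (form lam f q)) :
    ∀ᶠ p in 𝓝 ((0 : ℂ), (0 : ℂ)), h (coverMap x₀ p) = h (x₀, H p) := by
  have h0a : (0 : ℂ).re < a := by simpa using ha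
  have hHan := hH.analyticAt 0 h0a
  have hH0 := hH.zero 0 h0a
  have hHy : partialY H (0, 0) = 1 := by simpa using hH.partialY_eq 0 h0a
  obtain ⟨Y, hYan, hHY, hYH⟩ := exists_fiber_inverse hHan hH0 (by rw [hHy]; exact one_ne_zero)
  have hY0 : Y (0, 0) = 0 := by simpa [hH0] using hYH.self_of_nhds
  have hc0 : coverMap x₀ (0, 0) = (x₀, 0) := by simp [coverMap]
  have htc : Tendsto (coverMap x₀) (𝓝 ((0 : ℂ), (0 : ℂ))) (𝓝 (x₀, 0)) := by
    simpa only [hc0] using tendsto_coverMap x₀ (0, 0)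
  -- in the coordinates `(t, w) = (t, H (t, y))` the first integral does not depend on `t`
  set σ : ℂ × ℂ → ℂ × ℂ := fun p => (p.1, Y p) with hσ
  have hσan : AnalyticAt ℂ σ (0, 0) := analyticAt_fst.prod hYan
  have hσ0 : σ (0, 0) = (0, 0) := by simp [hσ, hY0]
  have hσt : Tendsto σ (𝓝 (0, 0)) (𝓝 (0, 0)) := by
    simpa only [hσ0] using hσan.continuousAt.tendsto
  set k : ℂ × ℂ → ℂ := fun p => h (coverMap x₀ p) with hk
  have hkan : AnalyticAt ℂ k (0, 0) :=
    hh.comp_of_eq (analyticAt_coverMap x₀ _) hc0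
  have hkpde : ∀ᶠ p in 𝓝 ((0 : ℂ), (0 : ℂ)),
      partialX k p + (lam + f (x₀ * Complex.exp p.1, p.2)) * p.2 * partialY k p = 0 := by
    filter_upwards [htc.eventually hw, htc.eventually hh.eventually_analyticAt] with p hp hpan
    obtain ⟨t, y⟩ := p
    have e1 : partialX k (t, y) =
        x₀ * Complex.exp t * partialX h (x₀ * Complex.exp t, y) := by
      have h1 := hasDerivAt_comp_pair (F := h) (u := fun t => x₀ * Complex.exp t)
        (v := fun _ => y) (s := t) hpan.differentiableAt
        ((Complex.hasDerivAt_exp t).const_mul x₀) (hasDerivAt_const t y)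
      have h2 := hasDerivAt_partialX (F := k) (x := t) (y := y)
        (hpan.comp_of_eq (analyticAt_coverMap x₀ _) rfl).differentiableAt
      rw [h2.unique h1]; ring
    have e2 : partialY k (t, y) = partialY h (x₀ * Complex.exp t, y) := by
      have h1 := hasDerivAt_partialY (F := h) (x := x₀ * Complex.exp t) (y := y)
        hpan.differentiableAt
      have h2 := hasDerivAt_partialY (F := k) (x := t) (y := y)
        (hpan.comp_of_eq (analyticAt_coverMap x₀ _) rfl).differentiableAt
      exact h2.unique h1
    rw [e1, e2]
    exact hp.pde
  have hqan : AnalyticAt ℂ (fun p => k (σ p)) (0, 0) := hkan.comp_of_eq hσan hσ0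
  have hqX : ∀ᶠ p in 𝓝 ((0 : ℂ), (0 : ℂ)), HasDerivAt (fun t => k (σ (t, p.2))) 0 p.1 := by
    have hHyne : ∀ᶠ p in 𝓝 ((0 : ℂ), (0 : ℂ)), partialY H p ≠ 0 :=
      (analyticAt_partialY hHan).continuousAt.eventually_ne (by rw [hHy]; exact one_ne_zero)
    filter_upwards [hσt.eventually hkpde, hσt.eventually (hH.pde 0 h0a), hσt.eventually hHyne,
      hσt.eventually hHan.eventually_analyticAt, hσt.eventually hkan.eventually_analyticAt,
      hYan.eventually_analyticAt, hHY.eventually_nhds] with p hk1 hH1 hne hHp hkp hYp hinv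
    obtain ⟨t, w⟩ := p
    have hYX := hasDerivAt_partialX hYp.differentiableAt
    have hinv' : (fun t => H (t, Y (t, w))) =ᶠ[𝓝 t] fun _ => w := eventually_base hinv
    have h1 := hasDerivAt_comp_pair (F := H) (u := id) (v := fun t => Y (t, w)) (s := t)
      hHp.differentiableAt (hasDerivAt_id t) hYX
    have h2 := h1.unique ((hasDerivAt_const t w).congr_of_eventuallyEq hinv')
    have h3 := hasDerivAt_comp_pair (F := k) (u := id) (v := fun t => Y (t, w)) (s := t)
      hkp.differentiableAt (hasDerivAt_id t) hYX
    refine h3.congr_deriv ?_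
    simp only [hσ, id, one_mul] at h2 hk1 hH1 hne ⊢
    have h4 : partialX Y (t, w) = (lam + f (x₀ * Complex.exp t, Y (t, w))) * Y (t, w) := by
      refine mul_right_cancel₀ hne ?_
      linear_combination h2 - hH1
    rw [h4]
    linear_combination hk1
  obtain ⟨δ, hδ, hball⟩ := Metric.eventually_nhds_iff_ball.1 hqX
  have hconst : ∀ p ∈ Metric.ball ((0 : ℂ), (0 : ℂ)) δ, k (σ p) = k (σ (0, p.2)) := by
    rintro ⟨t, w⟩ hp
    rw [← ball_prod_same] at hp
    have hz : ∀ s ∈ Metric.ball (0 : ℂ) δ, HasDerivAt (fun t => k (σ (t, w))) 0 s := by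
      intro s hs
      refine hball (s, w) ?_
      rw [← ball_prod_same]
      exact ⟨hs, hp.2⟩
    exact Metric.isOpen_ball.is_const_of_deriv_eq_zero (convex_ball (0 : ℂ) δ).isPreconnected
      (fun s hs => (hz s hs).differentiableAt.differentiableWithinAt)
      (fun s hs => (hz s hs).deriv) hp.1 (Metric.mem_ball_self hδ)
  have hY0w : ∀ᶠ w in 𝓝 (0 : ℂ), Y (0, w) = w := by
    filter_upwards [eventually_fiber hYH, hH.init] with w h1 h2
    simpa [h2] using h1
  have hHt : Tendsto H (𝓝 (0, 0)) (𝓝 0) := by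
    simpa only [hH0] using hHan.continuousAt.tendsto
  have hpH : Tendsto (fun p : ℂ × ℂ => (p.1, H p)) (𝓝 (0, 0)) (𝓝 (0, 0)) :=
    (continuous_fst.tendsto' ((0 : ℂ), (0 : ℂ)) 0 rfl).prodMk_nhds hHt
  filter_upwards [hYH, hpH.eventually (Metric.ball_mem_nhds _ hδ), hHt.eventually hY0w]
    with p hp hpb hpw
  have h1 := hconst _ hpb
  simp only [hσ, hp, hpw, hk] at h1
  rw [h1]
  simp [coverMap]

/-- Continuing a minimal first integral `h` along the loop amounts to translating
`χ ∘ H` by `2 * π * I` on the universal cover, where `χ` is the restriction of `h` to the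
transversal `x = x₀`. -/
theorem HasMonodromy.translate {lam a : ℝ} {f h H : ℂ × ℂ → ℂ} {x₀ : ℂ} {φ : ℂ → ℂ} (ha : 0 < a)
    (hx₀ : x₀ ≠ 0) (hH : IsCoverFirstIntegral lam a f x₀ H) (hm : HasMonodromy lam f x₀ h φ) :
    IsDiffGerm (fun w => h (x₀, w)) ∧ deriv (fun w => h (x₀, w)) 0 = partialY h (x₀, 0) ∧
      ∀ᶠ p in 𝓝 ((0 : ℂ), (0 : ℂ)),
        h (x₀, H (p.1 + 2 * Real.pi * Complex.I, p.2)) = φ (h (x₀, H p)) := by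
  obtain ⟨hφ, K, hK, hK0, hK1⟩ := hm
  have hl0 : loop x₀ 0 = (x₀, 0) := by simp [loop]
  have hmin0 := (hK 0 ⟨le_rfl, zero_le_one⟩).1
  rw [hl0] at hmin0
  have hyne : partialY (K 0) (x₀, 0) ≠ 0 := partialY_ne_zero_of_minimal hx₀ hmin0
  have hhan : AnalyticAt ℂ h (x₀, 0) := hmin0.1.congr hK0
  have hh0 : h (x₀, 0) = 0 := by rw [← hK0.self_of_nhds]; exact hmin0.2.1
  have hyeq : partialY h (x₀, 0) = partialY (K 0) (x₀, 0) := by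
    rw [partialY, partialY, hK0.fderiv_eq]
  have hder := (hasDerivAt_partialY hhan.differentiableAt).deriv
  have hχan : AnalyticAt ℂ (fun w => h (x₀, w)) 0 :=
    hhan.comp_of_eq (f := fun w : ℂ => (x₀, w)) (analyticAt_const.prod analyticAt_id) rfl
  refine ⟨⟨hχan, hh0, by rw [hder, hyeq]; exact hyne⟩, hder, ?_⟩
  have hw : ∀ᶠ q in 𝓝 (x₀, (0 : ℂ)), WedgeZero (fderiv ℂ h q) (form lam f q) := by
    filter_upwards [hmin0.2.2.2, hK0.eventually_nhds] with q h1 h2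
    have h2' : K 0 =ᶠ[𝓝 q] h := h2
    rwa [← h2'.fderiv_eq]
  have hstart := firstIntegral_eq_comp ha hH hhan hw
  set G : ℂ × ℂ → ℂ := fun p => h (x₀, H p) with hG
  let τ : ℝ → ℂ × ℂ := fun s => (2 * Real.pi * Complex.I * s, 0)
  have hτc : Continuous τ := by fun_prop
  have hτre : ∀ s, (τ s).1.re < a := fun s => by simpa [τ] using ha
  have hcτ : ∀ s, coverMap x₀ (τ s) = loop x₀ s := fun s => rfl
  have hGan : ∀ s, AnalyticAt ℂ G (τ s) := fun s =>
    hχan.comp_of_eq (hH.analyticAt _ (hτre s)) (hH.zero _ (hτre s))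
  -- the set of parameters at which the continuation agrees with `G` is open and closed
  let Q : ℝ → Prop := fun s => (fun p => K s (coverMap x₀ p)) =ᶠ[𝓝 (τ s)] G
  have hstep : ∀ s ∈ Set.Icc (0 : ℝ) 1, ∀ᶠ s' in 𝓝[Set.Icc (0 : ℝ) 1] s, (Q s ↔ Q s') := by
    intro s hs
    obtain ⟨hmin, hnear⟩ := hK s hs
    have hKan : AnalyticAt ℂ (fun p => K s (coverMap x₀ p)) (τ s) :=
      hmin.1.comp_of_eq (analyticAt_coverMap x₀ _) (hcτ s)
    obtain ⟨δ, hδ, hball⟩ := Metric.eventually_nhds_iff_ball.1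
      (hKan.eventually_analyticAt.and (hGan s).eventually_analyticAt)
    have hτs : ∀ᶠ s' in 𝓝[Set.Icc (0 : ℝ) 1] s, τ s' ∈ Metric.ball (τ s) δ :=
      (hτc.tendsto s).mono_left nhdsWithin_le_nhds |>.eventually (Metric.ball_mem_nhds _ hδ)
    filter_upwards [hnear, hτs] with s' h1 h2
    have h3 : (fun p => K s' (coverMap x₀ p)) =ᶠ[𝓝 (τ s')] fun p => K s (coverMap x₀ p) := by
      have := tendsto_coverMap x₀ (τ s')
      rw [hcτ] at this
      exact this.eventually h1
    have e1 : AnalyticOnNhd ℂ (fun p => K s (coverMap x₀ p)) (Metric.ball (τ s) δ) :=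
      fun p hp => (hball p hp).1
    have e2 : AnalyticOnNhd ℂ G (Metric.ball (τ s) δ) := fun p hp => (hball p hp).2
    constructor
    · intro hQ
      exact h3.trans
        (eventuallyEq_of_analyticOnNhd_ball e1 e2 (Metric.mem_ball_self hδ) h2 hQ)
    · intro hQ
      exact eventuallyEq_of_analyticOnNhd_ball e1 e2 h2 (Metric.mem_ball_self hδ)
        (h3.symm.trans hQ)
  have hQ01 : Q 0 ↔ Q 1 :=
    isPreconnected_Icc.induction₂ (fun s s' => (Q s ↔ Q s')) hstep
      (fun _ _ _ _ _ _ h1 h2 => h1.trans h2) (fun _ _ _ _ h => h.symm)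
      (Set.left_mem_Icc.2 zero_le_one) (Set.right_mem_Icc.2 zero_le_one)
  have hτ0 : τ 0 = (0, 0) := by simp [τ]
  have htc0 : Tendsto (coverMap x₀) (𝓝 ((0 : ℂ), (0 : ℂ))) (𝓝 (x₀, 0)) := by
    have := tendsto_coverMap x₀ (0, 0)
    simpa [coverMap] using this
  have hQ0 : Q 0 := by
    change (fun p => K 0 (coverMap x₀ p)) =ᶠ[𝓝 (τ 0)] G
    rw [hτ0]
    filter_upwards [hstart, htc0.eventually hK0] with p h1 h2
    rw [h2, h1]
  have hQ1 : ∀ᶠ p in 𝓝 (τ 1), K 1 (coverMap x₀ p) = G p := hQ01.1 hQ0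
  have htr : Tendsto (fun p : ℂ × ℂ => (p.1 + 2 * Real.pi * Complex.I, p.2))
      (𝓝 ((0 : ℂ), (0 : ℂ))) (𝓝 (τ 1)) := by
    refine Continuous.tendsto' (by fun_prop) _ _ ?_
    simp [τ]
  filter_upwards [htr.eventually hQ1, htc0.eventually hK1, hstart] with p h1 h2 h3
  have h4 : coverMap x₀ (p.1 + 2 * Real.pi * Complex.I, p.2) = coverMap x₀ p := by
    simp [coverMap, Complex.exp_add, Complex.exp_two_pi_mul_I]
  rw [h4, h2] at h1
  exact h1.symm.trans (congrArg φ h3)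

/-! ### Transition germs between two first integrals -/

/-- `G` is a coordinate on the fibres over the points of `{re t < a}`, centred at `y = 0`. -/
structure IsFiberCoordinate (a : ℝ) (G : ℂ × ℂ → ℂ) : Prop where
  analyticAt : ∀ t : ℂ, t.re < a → AnalyticAt ℂ G (t, 0)
  zero : ∀ t : ℂ, t.re < a → G (t, 0) = 0
  partialY_ne : ∀ t : ℂ, t.re < a → partialY G (t, 0) ≠ 0

lemma IsCoverFirstIntegral.partialY_comp {lam a : ℝ} {f H : ℂ × ℂ → ℂ} {x₀ : ℂ} {E : ℂ → ℂ}
    (hH : IsCoverFirstIntegral lam a f x₀ H) (hE : IsDiffGerm E) {t : ℂ} (ht : t.re < a) :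
    partialY (fun p => E (H p)) (t, 0) = deriv E 0 * Complex.exp (-lam * t) := by
  have hHan := hH.analyticAt t ht
  have h1 : HasDerivAt (fun y => H (t, y)) (Complex.exp (-lam * t)) 0 := by
    rw [← hH.partialY_eq t ht]
    exact hasDerivAt_partialY hHan.differentiableAt
  have h2 : AnalyticAt ℂ (fun p => E (H p)) (t, 0) := hE.1.comp_of_eq hHan (hH.zero t ht)
  have hEd : HasDerivAt E (deriv E 0) (H (t, 0)) := by
    rw [hH.zero t ht]; exact hE.1.differentiableAt.hasDerivAt
  exact (hasDerivAt_partialY h2.differentiableAt).unique (hEd.comp (0 : ℂ) h1)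

lemma IsCoverFirstIntegral.isFiberCoordinate {lam a : ℝ} {f H : ℂ × ℂ → ℂ} {x₀ : ℂ} {E : ℂ → ℂ}
    (hH : IsCoverFirstIntegral lam a f x₀ H) (hE : IsDiffGerm E) :
    IsFiberCoordinate a (fun p => E (H p)) where
  analyticAt t ht := hE.1.comp_of_eq (hH.analyticAt t ht) (hH.zero t ht)
  zero t ht := by rw [hH.zero t ht, hE.2.1]
  partialY_ne t ht := by
    rw [hH.partialY_comp hE ht]
    exact mul_ne_zero hE.2.2 (Complex.exp_ne_zero _)

/-- Fibre coordinates are injective on fibres, uniformly near `(t, 0)`; stated for two families of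
points tending to `(t, 0)`. -/
lemma IsFiberCoordinate.eventually_injective {a : ℝ} {G : ℂ × ℂ → ℂ} (hG : IsFiberCoordinate a G)
    {t : ℂ} (ht : t.re < a) {α : Type*} {l : Filter α} {u v : α → ℂ × ℂ}
    (hu : Tendsto u l (𝓝 (t, 0))) (hv : Tendsto v l (𝓝 (t, 0)))
    (h1 : ∀ᶠ i in l, (u i).1 = (v i).1) (h : ∀ᶠ i in l, G (u i) = G (v i)) :
    ∀ᶠ i in l, u i = v i := by
  obtain ⟨Y, -, -, hY⟩ := exists_fiber_inverse (hG.analyticAt t ht) (hG.zero t ht)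
    (hG.partialY_ne t ht)
  filter_upwards [hu.eventually hY, hv.eventually hY, h1, h] with i h1 h2 h3 h4
  refine Prod.ext h3 ?_
  rw [← h1, ← h2, h3, h4]

/-- `φ` represents the germ at `(t, 0)` of the transition from the fibre coordinate `G₁` to the
fibre coordinate `G₂`: the solution of `G₂ (x, φ (x, y)) = G₁ (x, y)` vanishing on `y = 0`. -/
structure IsTransition (G₁ G₂ : ℂ × ℂ → ℂ) (t : ℂ) (φ : ℂ × ℂ → ℂ) : Prop where
  analyticAt : AnalyticAt ℂ φ (t, 0)
  zero : ∀ᶠ s in 𝓝 t, φ (s, 0) = 0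
  eq : ∀ᶠ p in 𝓝 (t, (0 : ℂ)), G₂ (p.1, φ p) = G₁ p

lemma IsTransition.tendsto {G₁ G₂ φ : ℂ × ℂ → ℂ} {t : ℂ} (hφ : IsTransition G₁ G₂ t φ) :
    Tendsto (fun p : ℂ × ℂ => (p.1, φ p)) (𝓝 (t, 0)) (𝓝 (t, 0)) := by
  have h := hφ.analyticAt.continuousAt.tendsto
  rw [hφ.zero.self_of_nhds] at h
  exact (continuous_fst.tendsto' (t, (0 : ℂ)) t rfl).prodMk_nhds h

lemma IsTransition.eventually {G₁ G₂ φ : ℂ × ℂ → ℂ} {t : ℂ} (hφ : IsTransition G₁ G₂ t φ) :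
    ∀ᶠ s in 𝓝 t, IsTransition G₁ G₂ s φ := by
  filter_upwards [eventually_base hφ.analyticAt.eventually_analyticAt,
    hφ.zero.eventually_nhds, eventually_base hφ.eq.eventually_nhds] with s h1 h2 h3
  exact ⟨h1, h2, h3⟩

lemma exists_isTransition {a : ℝ} {G₁ G₂ : ℂ × ℂ → ℂ} (hG₁ : IsFiberCoordinate a G₁)
    (hG₂ : IsFiberCoordinate a G₂) {t : ℂ} (ht : t.re < a) :
    ∃ φ, IsTransition G₁ G₂ t φ := by
  obtain ⟨Y, hYan, hGY, hYG⟩ := exists_fiber_inverse (hG₂.analyticAt t ht) (hG₂.zero t ht)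
    (hG₂.partialY_ne t ht)
  have hσ : AnalyticAt ℂ (fun p : ℂ × ℂ => (p.1, G₁ p)) (t, 0) :=
    analyticAt_fst.prod (hG₁.analyticAt t ht)
  have hσ0 : (fun p : ℂ × ℂ => (p.1, G₁ p)) (t, 0) = (t, 0) := by simp [hG₁.zero t ht]
  have hσt : Tendsto (fun p : ℂ × ℂ => (p.1, G₁ p)) (𝓝 (t, 0)) (𝓝 (t, 0)) := by
    have := hσ.continuousAt.tendsto
    rwa [show ((t, (0 : ℂ)).1, G₁ (t, 0)) = (t, 0) from hσ0] at this
  refine ⟨fun p => Y (p.1, G₁ p), hYan.comp_of_eq hσ hσ0, ?_, hσt.eventually hGY⟩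
  filter_upwards [eventually_base hYG, (isOpen_re_lt a).mem_nhds ht] with s h1 h2
  rw [hG₂.zero s h2] at h1
  rw [hG₁.zero s h2, h1]

lemma IsTransition.unique {a : ℝ} {G₁ G₂ φ ψ : ℂ × ℂ → ℂ} (hG₂ : IsFiberCoordinate a G₂) {t : ℂ}
    (ht : t.re < a) (hφ : IsTransition G₁ G₂ t φ) (hψ : IsTransition G₁ G₂ t ψ) :
    φ =ᶠ[𝓝 (t, 0)] ψ := by
  have h := hG₂.eventually_injective ht hφ.tendsto hψ.tendsto (Eventually.of_forall fun _ => rfl)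
    (by filter_upwards [hφ.eq, hψ.eq] with p h1 h2; rw [h1, h2])
  filter_upwards [h] with p hp using congrArg Prod.snd hp

/-- The coefficients of the transition germs are holomorphic functions on the half-plane. -/
theorem exists_transition_coeffs {a : ℝ} {G₁ G₂ : ℂ × ℂ → ℂ} (hG₁ : IsFiberCoordinate a G₁)
    (hG₂ : IsFiberCoordinate a G₂) :
    ∃ c : ℕ → ℂ → ℂ, (∀ n, DifferentiableOn ℂ (c n) {t | t.re < a}) ∧
      ∀ t : ℂ, t.re < a → ∀ φ, IsTransition G₁ G₂ t φ → ∀ n, c n t = fiberCoeff φ n t := by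
  have hex : ∀ t : ℂ, ∃ φ, t.re < a → IsTransition G₁ G₂ t φ := by
    intro t
    by_cases ht : t.re < a
    · obtain ⟨φ, hφ⟩ := exists_isTransition hG₁ hG₂ ht
      exact ⟨φ, fun _ => hφ⟩
    · exact ⟨0, fun h => absurd h ht⟩
  choose Φ hΦ using hex
  have hc : ∀ t : ℂ, t.re < a → ∀ φ, IsTransition G₁ G₂ t φ → ∀ n,
      fiberCoeff (Φ t) n t = fiberCoeff φ n t := fun t ht φ hφ n =>
    fiberCoeff_congr n (eventually_fiber ((hΦ t ht).unique hG₂ ht hφ))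
  refine ⟨fun n t => fiberCoeff (Φ t) n t, fun n t ht => ?_, hc⟩
  have h1 : (fun s => fiberCoeff (Φ s) n s) =ᶠ[𝓝 t] fiberCoeff (Φ t) n := by
    filter_upwards [(hΦ t ht).eventually, (isOpen_re_lt a).mem_nhds ht] with s h1 h2
    exact hc s h2 _ h1 n
  exact (((analyticAt_fiberCoeff (hΦ t ht).analyticAt n).congr h1.symm).differentiableAt
    ).differentiableWithinAt

/-- If a translation of the base acts on both fibre coordinates by the same germ, then the
coefficients of the transition germs are periodic. -/
lemma transition_coeffs_periodic {a : ℝ} (ha : 0 < a) {G₁ G₂ : ℂ × ℂ → ℂ} {c : ℕ → ℂ → ℂ}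
    (hG₁ : IsFiberCoordinate a G₁) (hG₂ : IsFiberCoordinate a G₂)
    (hcd : ∀ n, DifferentiableOn ℂ (c n) {t | t.re < a})
    (hc : ∀ t : ℂ, t.re < a → ∀ φ, IsTransition G₁ G₂ t φ → ∀ n, c n t = fiberCoeff φ n t)
    {μ : ℂ → ℂ} {T : ℂ} (hT : T.re = 0)
    (h₁ : ∀ᶠ p in 𝓝 ((0 : ℂ), (0 : ℂ)), G₁ (p.1 + T, p.2) = μ (G₁ p))
    (h₂ : ∀ᶠ p in 𝓝 ((0 : ℂ), (0 : ℂ)), G₂ (p.1 + T, p.2) = μ (G₂ p))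
    (n : ℕ) {t : ℂ} (ht : t.re < a) : c n (t + T) = c n t := by
  have h0 : (0 : ℂ).re < a := by simpa using ha
  obtain ⟨φ, hφ⟩ := exists_isTransition hG₁ hG₂ h0
  -- translating the transition germ at `0` gives the transition germ at `T`
  set φT : ℂ × ℂ → ℂ := fun p => φ (p.1 - T, p.2) with hφT
  have htr : ∀ s : ℂ, Tendsto (fun p : ℂ × ℂ => (p.1 - T, p.2)) (𝓝 (s, 0)) (𝓝 (s - T, 0)) :=
    fun s => Continuous.tendsto' (by fun_prop) _ _ rfl
  have hφT' : IsTransition G₁ G₂ T φT := by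
    refine ⟨?_, ?_, ?_⟩
    · exact hφ.analyticAt.comp_of_eq (f := fun p : ℂ × ℂ => (p.1 - T, p.2))
        ((analyticAt_fst.sub analyticAt_const).prod analyticAt_snd) (by simp)
    · have : Tendsto (fun s : ℂ => s - T) (𝓝 T) (𝓝 0) :=
        Continuous.tendsto' (by fun_prop) _ _ (sub_self T)
      exact this.eventually hφ.zero
    · have h3 := htr T
      rw [sub_self] at h3
      filter_upwards [h3.eventually hφ.eq, h3.eventually h₁,
        h3.eventually (hφ.tendsto.eventually h₂)] with p e1 e2 e3
      simp only [sub_add_cancel] at e1 e2 e3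
      rw [hφT, e3, e1, ← e2]
  have hnear : (fun s => c n (s + T)) =ᶠ[𝓝 0] c n := by
    have htT : Tendsto (fun s : ℂ => s + T) (𝓝 0) (𝓝 T) :=
      Continuous.tendsto' (by fun_prop) _ _ (zero_add T)
    filter_upwards [htT.eventually hφT'.eventually, hφ.eventually,
      (isOpen_re_lt a).mem_nhds h0] with s h1 h2 h3
    have h3' : s.re < a := h3
    rw [hc s h3 φ h2, hc (s + T) (by simpa [hT] using h3') φT h1]
    exact fiberCoeff_congr n (Eventually.of_forall fun y => by simp [hφT])
  have hD := isOpen_re_lt a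
  have h4 : AnalyticOnNhd ℂ (c n) {t | t.re < a} := (hcd n).analyticOnNhd hD
  have h5 : AnalyticOnNhd ℂ (fun s => c n (s + T)) {t | t.re < a} := by
    refine DifferentiableOn.analyticOnNhd (fun s hs => ?_) hD
    have hs' : s.re < a := hs
    have hsT : s + T ∈ {t : ℂ | t.re < a} := by simpa [hT] using hs'
    exact (DifferentiableAt.comp (g := c n) s ((hcd n).differentiableAt (hD.mem_nhds hsT))
      (by fun_prop : DifferentiableAt ℂ (fun s => s + T) s)).differentiableWithinAt
  exact h5.eqOn_of_preconnected_of_eventuallyEq h4 (convex_halfSpace_re_lt a).isPreconnected h0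
    hnear ht

/-! ### Subexponential bounds for the transition coefficients -/

/-- A quantitative inverse function theorem: on a disc on which `K'` is close to `μ`, the inverse
of `K` is defined on a disc of comparable radius. -/
lemma exists_inverse_on_ball {K : ℂ → ℂ} {μ : ℂ} {s : ℝ} (hμ : μ ≠ 0) (hs : 0 < s) (h0 : K 0 = 0)
    (hK : ∀ y, ‖y‖ < s → DifferentiableAt ℂ K y ∧ ‖deriv K y - μ‖ ≤ ‖μ‖ / 2) :
    (∀ y, ‖y‖ < s → ‖K y‖ ≤ 2 * ‖μ‖ * ‖y‖) ∧
    ∃ N : ℂ → ℂ, DifferentiableOn ℂ N (Metric.ball 0 (‖μ‖ * s / 4)) ∧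
      ∀ w, ‖w‖ < ‖μ‖ * s / 4 → ‖N w‖ ≤ 2 / ‖μ‖ * ‖w‖ ∧ K (N w) = w := by
  have hμ0 : 0 < ‖μ‖ := norm_pos_iff.2 hμ
  have happ : ∀ x ∈ Metric.ball (0 : ℂ) s, ∀ y ∈ Metric.ball (0 : ℂ) s,
      ‖K x - K y - μ * (x - y)‖ ≤ ‖μ‖ / 2 * ‖x - y‖ := by
    intro x hx y hy
    have hd : ∀ z ∈ Metric.ball (0 : ℂ) s,
        HasDerivAt (fun z => K z - μ * z) (deriv K z - μ) z := by
      intro z hz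
      have h1 := (hK z (by simpa using hz)).1.hasDerivAt.sub ((hasDerivAt_id z).const_mul μ)
      rwa [mul_one] at h1
    have h2 := (convex_ball (0 : ℂ) s).norm_image_sub_le_of_norm_hasDerivWithin_le
      (fun z hz => (hd z hz).hasDerivWithinAt) (fun z hz => (hK z (by simpa using hz)).2) hy hx
    have e : K x - K y - μ * (x - y) = K x - μ * x - (K y - μ * y) := by ring
    rw [e]
    exact h2
  have hmem0 : (0 : ℂ) ∈ Metric.ball (0 : ℂ) s := Metric.mem_ball_self hs
  have hlow : ∀ y, ‖y‖ < s → ‖K y - μ * y‖ ≤ ‖μ‖ / 2 * ‖y‖ := by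
    intro y hy
    simpa [h0] using happ y (by simpa using hy) 0 hmem0
  refine ⟨fun y hy => ?_, ?_⟩
  · calc ‖K y‖ = ‖(K y - μ * y) + μ * y‖ := by ring_nf
      _ ≤ ‖K y - μ * y‖ + ‖μ * y‖ := norm_add_le _ _
      _ ≤ ‖μ‖ / 2 * ‖y‖ + ‖μ‖ * ‖y‖ := by rw [norm_mul]; gcongr; exact hlow y hy
      _ ≤ 2 * ‖μ‖ * ‖y‖ := by nlinarith [mul_nonneg hμ0.le (norm_nonneg y)]
  · let i : ℂ ≃L[ℂ] ℂ := ContinuousLinearEquiv.unitsEquivAut ℂ (Units.mk0 μ hμ)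
    have hi : ∀ z, i z = μ * z := fun z => by simp [i, mul_comm]
    have hisymm : ∀ z, i.symm z = μ⁻¹ * z := fun z => by
      rw [ContinuousLinearEquiv.symm_apply_eq, hi]; field_simp
    have hinorm : ‖(i.symm : ℂ →L[ℂ] ℂ)‖ = ‖μ‖⁻¹ := by
      have : (i.symm : ℂ →L[ℂ] ℂ) = μ⁻¹ • ContinuousLinearMap.id ℂ ℂ := by
        ext; simp [hisymm]
      rw [this, norm_smul, ContinuousLinearMap.norm_id, mul_one, norm_inv]
    set c : NNReal := Real.toNNReal (‖μ‖ / 2)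
    have hc : (c : ℝ) = ‖μ‖ / 2 := Real.coe_toNNReal _ (by positivity)
    have hA : ApproximatesLinearOn K (i : ℂ →L[ℂ] ℂ) (Metric.ball 0 s) c := by
      intro x hx y hy
      have := happ x hx y hy
      simpa [hi, hc] using this
    have hcn : (c : ℝ) < ‖(i.symm : ℂ →L[ℂ] ℂ)‖⁻¹ := by
      rw [hinorm, inv_inv, hc]; exact half_lt_self hμ0
    have hcc : Subsingleton ℂ ∨ c < ‖(i.symm : ℂ →L[ℂ] ℂ)‖₊⁻¹ := Or.inr (by exact_mod_cast hcn)
    let R := hA.toOpenPartialHomeomorph K (Metric.ball 0 s) hcc Metric.isOpen_ball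
    have htarget : ∀ w, ‖w‖ < ‖μ‖ * s / 4 → w ∈ R.target := by
      intro w hw
      have hsub : Metric.closedBall (0 : ℂ) (s / 2) ⊆ Metric.ball 0 s :=
        Metric.closedBall_subset_ball (by linarith)
      have h1 := hA.closedBall_subset_target hcc Metric.isOpen_ball (half_pos hs).le hsub
      refine h1 ?_
      rw [h0, mem_closedBall_zero_iff]
      have h2 : ((‖(i.symm : ℂ →L[ℂ] ℂ)‖₊⁻¹ : NNReal) : ℝ) = ‖μ‖ := by
        simp [hinorm]
      have h3 : ((‖(i.symm : ℂ →L[ℂ] ℂ)‖₊⁻¹ : NNReal) : ℝ) - c = ‖μ‖ / 2 := by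
        rw [h2, hc]; ring
      rw [h3]
      linarith
    have hRN : ∀ w, ‖w‖ < ‖μ‖ * s / 4 → ‖R.symm w‖ < s ∧ K (R.symm w) = w := by
      intro w hw
      have h1 : R.symm w ∈ Metric.ball (0 : ℂ) s := R.map_target (htarget w hw)
      exact ⟨by simpa using h1, R.right_inv (htarget w hw)⟩
    refine ⟨R.symm, fun w hw => ?_, fun w hw => ?_⟩
    · have hw' : ‖w‖ < ‖μ‖ * s / 4 := by simpa using hw
      obtain ⟨h1, h2⟩ := hRN w hw'
      have h3 := hK _ h1
      have hne : deriv K (R.symm w) ≠ 0 := by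
        intro h4
        have := h3.2
        rw [h4, zero_sub, norm_neg] at this
        linarith
      exact (R.hasDerivAt_symm (htarget w hw') hne h3.1.hasDerivAt
        ).differentiableAt.differentiableWithinAt
    · obtain ⟨h1, h2⟩ := hRN w hw
      refine ⟨?_, h2⟩
      have h3 := hlow _ h1
      rw [h2] at h3
      have h4 : ‖μ‖ * ‖R.symm w‖ ≤ ‖w‖ + ‖μ‖ / 2 * ‖R.symm w‖ := by
        calc ‖μ‖ * ‖R.symm w‖ = ‖w - (w - μ * R.symm w)‖ := by rw [← norm_mul]; ring_nf
          _ ≤ ‖w‖ + ‖w - μ * R.symm w‖ := norm_sub_le _ _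
          _ ≤ _ := by gcongr
      rw [div_mul_eq_mul_div, le_div_iff₀ hμ0]
      linarith

/-- The coefficient of `y ^ n` in the transition germ over `t` grows at most like
`exp (n * ε * ‖t‖)` as `re t → -∞`, for every `ε > 0`, because on the fibre over `t` the transition
extends to a bounded holomorphic function on a disc of radius `exp (-ε * ‖t‖)`, up to a constant. -/
theorem exists_transition_coeff_bound {lam a : ℝ} (hlam : lam ≤ 0) {f₁ f₂ H₁ H₂ : ℂ × ℂ → ℂ}
    {x₀ : ℂ} {E₁ E₂ : ℂ → ℂ} (hH₁ : IsCoverFirstIntegral lam a f₁ x₀ H₁)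
    (hH₂ : IsCoverFirstIntegral lam a f₂ x₀ H₂) (hE₁ : IsDiffGerm E₁) (hE₂ : IsDiffGerm E₂)
    {b : ℝ} (hb : b < a) {ε : ℝ} (hε : 0 < ε) :
    ∃ C R : ℝ, 0 < C ∧ 0 < R ∧ ∀ t : ℂ, t.re ≤ b → ∀ φ,
      IsTransition (fun p => E₁ (H₁ p)) (fun p => E₂ (H₂ p)) t φ →
        ∀ n, ‖fiberCoeff φ n t‖ ≤ C * (R * Real.exp (ε * ‖t‖)) ^ n := by
  obtain ⟨B₁, hB₁, hb₁⟩ := hH₁.bound b hb ε hε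
  obtain ⟨B₂, hB₂, hb₂⟩ := hH₂.bound b hb ε hε
  -- the germ `g = E₂⁻¹ ∘ E₁`
  obtain ⟨K, hKan, hK0, hEK, -⟩ := exists_germ_inverse hE₂.1 hE₂.2.1 hE₂.2.2
  set g : ℂ → ℂ := fun w => K (E₁ w) with hg
  have hE₁t : Tendsto E₁ (𝓝 0) (𝓝 0) := by
    have := hE₁.1.continuousAt.tendsto
    rwa [hE₁.2.1] at this
  have hgan : AnalyticAt ℂ g 0 := hKan.comp_of_eq hE₁.1 hE₁.2.1
  have hg0 : g 0 = 0 := by simp [hg, hE₁.2.1, hK0]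
  obtain ⟨D, hD⟩ := hgan.differentiableAt.isBigO_sub.bound
  obtain ⟨σ, hσ, hgσ⟩ := Metric.eventually_nhds_iff_ball.1
    (hgan.eventually_analyticAt.and ((hE₁t.eventually hEK).and hD))
  set D' := max D 1 with hD'
  have hD1 : 1 ≤ D' := le_max_right _ _
  have hgD : ∀ w, ‖w‖ < σ → ‖g w‖ ≤ D' * ‖w‖ := by
    intro w hw
    have := (hgσ w (by simpa using hw)).2.2
    simp only [hg0, sub_zero] at this
    exact this.trans (by gcongr; exact le_max_left _ _)
  set M := Real.exp (-lam * b) with hM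
  have hM0 : 0 < M := Real.exp_pos _
  set B := max B₁ B₂ with hB
  have hB1 : 1 ≤ B := hB₁.trans (le_max_left _ _)
  -- on the disc of radius `s * η`, `H₁` takes its values in the domain of `g`, and `g ∘ H₁` in the
  -- domain of the inverse of `H₂` given by `exists_inverse_on_ball`
  set η := min (1 / (16 * D')) (σ / (4 * M)) with hη
  have hη0 : 0 < η := by positivity
  have hη1 : η ≤ 1 / (16 * D') := min_le_left _ _
  have hη2 : η ≤ σ / (4 * M) := min_le_right _ _
  refine ⟨4 * D', 2 * B / η, by positivity, by positivity, fun t ht φ hφ n => ?_⟩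
  have hta := ht.trans_lt hb
  set μ := Complex.exp (-lam * t) with hμ
  have hμ0 : μ ≠ 0 := Complex.exp_ne_zero _
  have hμpos : 0 < ‖μ‖ := norm_pos_iff.2 hμ0
  have hμM : ‖μ‖ ≤ M := by
    have := norm_exp_ofReal_mul (-lam) t
    rw [Complex.ofReal_neg] at this
    rw [hμ, this]
    apply Real.exp_le_exp.2
    nlinarith
  set s := 1 / (B * Real.exp (ε * ‖t‖)) with hs
  have hexp1 : 1 ≤ Real.exp (ε * ‖t‖) := Real.one_le_exp (by positivity)
  have hBe : 1 ≤ B * Real.exp (ε * ‖t‖) := one_le_mul_of_one_le_of_one_le hB1 hexp1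
  have hs0 : 0 < s := by positivity
  have hs1 : s ≤ 1 := (div_le_one (by positivity)).2 hBe
  have hsmall : ∀ {B'}, B' ≤ B → ∀ {y : ℂ}, ‖y‖ < s → B' * Real.exp (ε * ‖t‖) * ‖y‖ < 1 := by
    intro B' hB' y hy
    rw [hs, lt_div_iff₀ (by positivity), mul_comm] at hy
    refine lt_of_le_of_lt ?_ hy
    gcongr
  have hK₁ := (exists_inverse_on_ball (K := fun y => H₁ (t, y)) hμ0 hs0 (hH₁.zero t hta)
    (fun y hy => hb₁ t ht y (hsmall (le_max_left _ _) hy))).1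
  obtain ⟨-, N, hNd, hN⟩ := exists_inverse_on_ball (K := fun y => H₂ (t, y)) hμ0 hs0
    (hH₂.zero t hta) (fun y hy => hb₂ t ht y (hsmall (le_max_right _ _) hy))
  set δ := s * η with hδ
  have hδ0 : 0 < δ := by positivity
  have hδs : δ ≤ s := by
    have : η ≤ 1 := hη1.trans ((div_le_one (by positivity)).2 (by linarith))
    exact mul_le_of_le_one_right hs0.le this
  have hδσ : 2 * M * δ < σ := by
    have h1 : δ ≤ σ / (4 * M) := (mul_le_of_le_one_left hη0.le hs1).trans hη2
    rw [le_div_iff₀ (by positivity)] at h1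
    linarith
  have hδD : 16 * D' * δ ≤ s := by
    have h1 : η * (16 * D') ≤ 1 := (le_div_iff₀ (by positivity)).1 hη1
    calc 16 * D' * δ = s * (η * (16 * D')) := by rw [hδ]; ring
      _ ≤ s := mul_le_of_le_one_right hs0.le h1
  have hstep : ∀ y : ℂ, ‖y‖ < δ → ‖H₁ (t, y)‖ < σ ∧ ‖g (H₁ (t, y))‖ < ‖μ‖ * s / 4 ∧
      ‖g (H₁ (t, y))‖ ≤ 2 * D' * ‖μ‖ * ‖y‖ := by
    intro y hy
    have h1 := hK₁ y (hy.trans_le hδs)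
    have h2 : ‖H₁ (t, y)‖ < σ := by
      refine h1.trans_lt (lt_of_le_of_lt ?_ hδσ)
      gcongr
    have h3 : ‖g (H₁ (t, y))‖ ≤ 2 * D' * ‖μ‖ * ‖y‖ := by
      refine (hgD _ h2).trans ?_
      calc D' * ‖H₁ (t, y)‖ ≤ D' * (2 * ‖μ‖ * ‖y‖) := by gcongr
        _ = _ := by ring
    refine ⟨h2, h3.trans_lt ?_, h3⟩
    have h4 : 2 * D' * ‖μ‖ * ‖y‖ ≤ 2 * D' * ‖μ‖ * δ := by gcongr
    have h5 : 2 * D' * ‖μ‖ * δ ≤ ‖μ‖ * s / 8 := by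
      calc 2 * D' * ‖μ‖ * δ = ‖μ‖ * (16 * D' * δ) / 8 := by ring
        _ ≤ _ := by gcongr
    have : 0 < ‖μ‖ * s := by positivity
    linarith
  set F : ℂ → ℂ := fun y => N (g (H₁ (t, y))) with hF
  have hFb : ∀ y : ℂ, ‖y‖ < δ → ‖F y‖ ≤ 4 * D' * ‖y‖ := by
    intro y hy
    obtain ⟨-, h2, h3⟩ := hstep y hy
    calc ‖F y‖ ≤ 2 / ‖μ‖ * ‖g (H₁ (t, y))‖ := (hN _ h2).1
      _ ≤ 2 / ‖μ‖ * (2 * D' * ‖μ‖ * ‖y‖) := by gcongr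
      _ = 4 * D' * ‖y‖ := by field_simp; ring
  have hFd : DifferentiableOn ℂ F (Metric.ball 0 δ) := by
    intro y hy
    have hy' : ‖y‖ < δ := by simpa using hy
    obtain ⟨h1, h2, -⟩ := hstep y hy'
    have d1 := (hb₁ t ht y (hsmall (le_max_left _ _) (hy'.trans_le hδs))).1
    have d2 := (hgσ _ (by simpa using h1 : H₁ (t, y) ∈ Metric.ball 0 σ)).1.differentiableAt
    have d3 : DifferentiableAt ℂ N (g (H₁ (t, y))) :=
      hNd.differentiableAt (Metric.isOpen_ball.mem_nhds (by simpa using h2))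
    have d12 : DifferentiableAt ℂ (fun y => g (H₁ (t, y))) y :=
      DifferentiableAt.comp (g := g) y d2 d1
    exact (DifferentiableAt.comp (g := N) y d3 d12).differentiableWithinAt
  have hφF : ∀ᶠ y in 𝓝 (0 : ℂ), φ (t, y) = F y := by
    have hFt : Tendsto F (𝓝 0) (𝓝 0) := by
      refine squeeze_zero_norm' (a := fun y : ℂ => 4 * D' * ‖y‖) ?_ ?_
      · filter_upwards [Metric.ball_mem_nhds (0 : ℂ) hδ0] with y hy
        exact hFb y (by simpa using hy)
      · exact Continuous.tendsto' (by fun_prop) _ _ (by simp)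
    have hpr : Tendsto (fun y : ℂ => (t, y)) (𝓝 0) (𝓝 (t, 0)) :=
      (continuous_pair_right t).tendsto 0
    have h := (hH₂.isFiberCoordinate hE₂).eventually_injective hta (l := 𝓝 (0 : ℂ))
      (u := fun y => (t, φ (t, y))) (v := fun y => (t, F y)) (hφ.tendsto.comp hpr)
      (tendsto_const_nhds.prodMk_nhds hFt) (Eventually.of_forall fun _ => rfl) ?_
    · filter_upwards [h] with y hy using congrArg Prod.snd hy
    · filter_upwards [eventually_fiber hφ.eq, Metric.ball_mem_nhds (0 : ℂ) hδ0] with y h1 hy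
      obtain ⟨h2, h3, -⟩ := hstep y (by simpa using hy)
      have h4 : E₂ (g (H₁ (t, y))) = E₁ (H₁ (t, y)) := (hgσ _ (by simpa using h2)).2.1
      have h5 : H₂ (t, F y) = g (H₁ (t, y)) := (hN _ h3).2
      rw [h5, h4]
      exact h1
  refine (norm_fiberCoeff_le hδ0 hFd (C := 4 * D') (fun y hy => ?_) hφF n).trans (le_of_eq ?_)
  · have hy' : ‖y‖ < δ := by simpa using hy
    refine (hFb y hy').trans (mul_le_of_le_one_right (by positivity) ?_)
    exact (hy'.le.trans hδs).trans hs1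
  · congr 2
    rw [hδ, hs]
    field_simp

/-! ### Descending to the disc -/

lemma norm_log_le (z : ℂ) : ‖Complex.log z‖ ≤ |Real.log ‖z‖| + Real.pi := by
  refine (Complex.norm_le_abs_re_add_abs_im _).trans ?_
  rw [Complex.log_re, Complex.log_im]
  gcongr
  exact Complex.abs_arg_le_pi z

lemma mul_exp_log_div {x₀ x : ℂ} (hx₀ : x₀ ≠ 0) (hx : x ≠ 0) :
    x₀ * Complex.exp (Complex.log (x / x₀)) = x := by
  rw [Complex.exp_log (div_ne_zero hx hx₀)]
  field_simp

/-- A periodic holomorphic function of `t` with `exp (‖t‖ / 2)` growth as `re t → -∞` is a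
holomorphic function of `x = x₀ * exp t` on the whole disc: its growth `‖x‖ ^ (-1 / 2)` makes the
singularity at the origin removable. -/
theorem exists_descent {a r : ℝ} {x₀ : ℂ} (hx₀ : x₀ ≠ 0) (ha0 : 0 < a)
    (ha : ∀ t : ℂ, t.re < a ↔ ‖x₀ * Complex.exp t‖ < r) {c : ℂ → ℂ}
    (hcd : DifferentiableOn ℂ c {t | t.re < a})
    (hper : ∀ t : ℂ, t.re < a → c (t + 2 * Real.pi * Complex.I) = c t) {C : ℝ}
    (hbd : ∀ t : ℂ, t.re ≤ 0 → ‖c t‖ ≤ C * Real.exp (‖t‖ / 2)) :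
    ∃ g : ℂ → ℂ, DifferentiableOn ℂ g (Metric.ball 0 r) ∧
      ∀ t : ℂ, t.re < a → g (x₀ * Complex.exp t) = c t := by
  have hC : 0 ≤ C := by
    have := (norm_nonneg _).trans (hbd 0 (by simp))
    simpa using this
  have hr : 0 < r := (norm_nonneg _).trans_lt ((ha 0).1 (by simpa using ha0))
  have hperZ : ∀ s t : ℂ, s.re < a → t.re < a → Complex.exp s = Complex.exp t → c s = c t := by
    intro s t hs ht hst
    -- extended by zero, `c` is periodic on the whole plane
    set c' : ℂ → ℂ := fun t => if t.re < a then c t else 0 with hc'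
    have hp : Function.Periodic c' (2 * Real.pi * Complex.I) := by
      intro t
      have hre : (t + 2 * Real.pi * Complex.I).re = t.re := by simp
      simp only [hc', hre]
      split_ifs with h
      · exact hper t h
      · rfl
    obtain ⟨n, hn⟩ := Complex.exp_eq_exp_iff_exists_int.1 hst
    have h1 := hp.int_mul n t
    rw [← hn] at h1
    simpa [hc', hs, ht] using h1
  have hlog : ∀ x : ℂ, x ≠ 0 → ‖x‖ < r → (Complex.log (x / x₀)).re < a := by
    intro x hx hxr
    rw [ha, mul_exp_log_div hx₀ hx]
    exact hxr
  set g : ℂ → ℂ := fun x => c (Complex.log (x / x₀)) with hg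
  have hgd : DifferentiableOn ℂ g (Metric.ball 0 r \ {0}) := by
    rintro x ⟨hxr, hx⟩
    have hx' : x ≠ 0 := hx
    have hxr' : ‖x‖ < r := by simpa using hxr
    set t₁ := Complex.log (x / x₀) with ht₁
    set ℓ : ℂ → ℂ := fun z => t₁ + Complex.log (z / x) with hℓ
    have hℓd : DifferentiableAt ℂ ℓ x := by
      refine DifferentiableAt.const_add _ (DifferentiableAt.clog (by fun_prop) ?_)
      rw [div_self hx']
      exact Complex.one_mem_slitPlane
    have hℓx : ℓ x = t₁ := by simp [hℓ, div_self hx']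
    have hD := isOpen_re_lt a
    have ht₁a : t₁ ∈ {t : ℂ | t.re < a} := hlog x hx' hxr'
    have h1 : DifferentiableAt ℂ (fun z => c (ℓ z)) x := by
      refine DifferentiableAt.comp (g := c) x ?_ hℓd
      rw [hℓx]
      exact hcd.differentiableAt (hD.mem_nhds ht₁a)
    have h2 : g =ᶠ[𝓝 x] fun z => c (ℓ z) := by
      have h3 : ∀ᶠ z in 𝓝 x, ℓ z ∈ {t : ℂ | t.re < a} :=
        hℓd.continuousAt.eventually (hD.mem_nhds (by rw [hℓx]; exact ht₁a))
      filter_upwards [h3, isOpen_ne.mem_nhds hx', Metric.isOpen_ball.mem_nhds hxr] with z e1 e2 e3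
      refine hperZ _ _ (hlog z e2 (by simpa using e3)) e1 ?_
      rw [Complex.exp_log (div_ne_zero e2 hx₀), hℓ]
      simp only
      rw [Complex.exp_add, ht₁, Complex.exp_log (div_ne_zero hx' hx₀),
        Complex.exp_log (div_ne_zero e2 hx')]
      field_simp
    exact (h1.congr_of_eventuallyEq h2).differentiableWithinAt
  have hgbound : ∀ x : ℂ, x ≠ 0 → ‖x‖ ≤ ‖x₀‖ →
      ‖g x‖ * ‖x‖ ≤ C * Real.exp (Real.pi / 2) * ‖x₀‖ * √(‖x‖ / ‖x₀‖) := by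
    intro x hx hxx
    have hx₀p : 0 < ‖x₀‖ := norm_pos_iff.2 hx₀
    set z := x / x₀ with hz
    have hz0 : 0 < ‖z‖ := norm_pos_iff.2 (div_ne_zero hx hx₀)
    have hzx : ‖z‖ = ‖x‖ / ‖x₀‖ := norm_div _ _
    have hz1 : ‖z‖ ≤ 1 := by rw [hzx]; exact (div_le_one hx₀p).2 hxx
    have hl0 : Real.log ‖z‖ ≤ 0 := Real.log_nonpos hz0.le hz1
    have h1 : ‖g x‖ ≤ C * Real.exp (‖Complex.log z‖ / 2) :=
      hbd _ (by rw [Complex.log_re]; exact hl0)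
    have h2 : ‖Complex.log z‖ ≤ -Real.log ‖z‖ + Real.pi := by
      have := norm_log_le z
      rwa [abs_of_nonpos hl0] at this
    have h3 : Real.exp (Real.log ‖z‖) = ‖z‖ := Real.exp_log hz0
    have h4 : √‖z‖ = Real.exp (Real.log ‖z‖ / 2) := by rw [Real.exp_half, h3]
    rw [← hzx, h4]
    have h5 : ‖x‖ = ‖x₀‖ * Real.exp (Real.log ‖z‖) := by rw [h3, hzx]; field_simp
    calc ‖g x‖ * ‖x‖ ≤ C * Real.exp ((-Real.log ‖z‖ + Real.pi) / 2) *
          (‖x₀‖ * Real.exp (Real.log ‖z‖)) := by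
          rw [h5]
          refine mul_le_mul_of_nonneg_right (h1.trans ?_) (by positivity)
          gcongr
      _ = C * ‖x₀‖ * (Real.exp ((-Real.log ‖z‖ + Real.pi) / 2) * Real.exp (Real.log ‖z‖)) := by
          ring
      _ = C * ‖x₀‖ * (Real.exp (Real.pi / 2) * Real.exp (Real.log ‖z‖ / 2)) := by
          rw [← Real.exp_add, ← Real.exp_add]; ring_nf
      _ = _ := by ring
  have ho : (fun z => g z - g 0) =o[𝓝[≠] 0] fun z => (z - 0)⁻¹ := by
    rw [Asymptotics.isLittleO_iff_tendsto']
    · have hlim : Tendsto (fun x : ℂ => C * Real.exp (Real.pi / 2) * ‖x₀‖ * √(‖x‖ / ‖x₀‖) +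
          ‖g 0‖ * ‖x‖) (𝓝[≠] 0) (𝓝 0) := by
        refine Tendsto.mono_left (Continuous.tendsto' (by fun_prop) _ _ ?_) nhdsWithin_le_nhds
        simp
      refine squeeze_zero_norm' ?_ hlim
      have hnear : ∀ᶠ x : ℂ in 𝓝[≠] 0, ‖x‖ ≤ ‖x₀‖ := by
        refine nhdsWithin_le_nhds ?_
        filter_upwards [Metric.ball_mem_nhds (0 : ℂ) (norm_pos_iff.2 hx₀)] with x hx
        have : ‖x‖ < ‖x₀‖ := by simpa using hx
        exact this.le
      filter_upwards [hnear, self_mem_nhdsWithin] with x h1 h2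
      rw [sub_zero, div_inv_eq_mul, norm_mul]
      calc ‖g x - g 0‖ * ‖x‖ ≤ (‖g x‖ + ‖g 0‖) * ‖x‖ := by gcongr; exact norm_sub_le _ _
        _ = ‖g x‖ * ‖x‖ + ‖g 0‖ * ‖x‖ := add_mul _ _ _
        _ ≤ _ := by linarith [hgbound x h2 h1]
    · filter_upwards [self_mem_nhdsWithin] with x hx h
      rw [sub_zero, inv_eq_zero] at h
      exact absurd h hx
  refine ⟨_, Complex.differentiableOn_update_limUnder_of_isLittleO
    (Metric.ball_mem_nhds (0 : ℂ) hr) hgd ho, fun t ht => ?_⟩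
  have hne : x₀ * Complex.exp t ≠ 0 := mul_ne_zero hx₀ (Complex.exp_ne_zero t)
  rw [Function.update_of_ne hne]
  refine hperZ _ _ (hlog _ hne ((ha t).1 ht)) ht ?_
  rw [Complex.exp_log (div_ne_zero hne hx₀)]
  field_simp

/-- The transition germs between two first integrals with the same monodromy glue to a map which is
analytic on a neighbourhood of the whole disc, including the origin. Its Taylor coefficients extend
holomorphically to the disc, and the maximum principle bounds them near the origin by their bounds
on a circle. -/
theorem exists_transition_map {lam a r : ℝ} (hlam : lam ≤ 0) {f₁ f₂ H₁ H₂ : ℂ × ℂ → ℂ}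
    {x₀ : ℂ} {E₁ E₂ μ : ℂ → ℂ} (hx₀ : x₀ ≠ 0) (ha0 : 0 < a)
    (ha : ∀ t : ℂ, t.re < a ↔ ‖x₀ * Complex.exp t‖ < r)
    (hH₁ : IsCoverFirstIntegral lam a f₁ x₀ H₁) (hH₂ : IsCoverFirstIntegral lam a f₂ x₀ H₂)
    (hE₁ : IsDiffGerm E₁) (hE₂ : IsDiffGerm E₂)
    (h₁ : ∀ᶠ p in 𝓝 ((0 : ℂ), (0 : ℂ)),
      E₁ (H₁ (p.1 + 2 * Real.pi * Complex.I, p.2)) = μ (E₁ (H₁ p)))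
    (h₂ : ∀ᶠ p in 𝓝 ((0 : ℂ), (0 : ℂ)),
      E₂ (H₂ (p.1 + 2 * Real.pi * Complex.I, p.2)) = μ (E₂ (H₂ p))) :
    ∃ φ : ℂ × ℂ → ℂ,
      (∀ x : ℂ, ‖x‖ < r → AnalyticAt ℂ φ (x, 0) ∧ φ (x, 0) = 0 ∧
        partialY φ (x, 0) = deriv E₁ 0 / deriv E₂ 0) ∧
      ∀ t : ℂ, t.re < a → ∀ᶠ p in 𝓝 (t, (0 : ℂ)),
        E₂ (H₂ (p.1, φ (coverMap x₀ p))) = E₁ (H₁ p) := by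
  have hG₁ := hH₁.isFiberCoordinate hE₁
  have hG₂ := hH₂.isFiberCoordinate hE₂
  obtain ⟨c, hcd, hc⟩ := exists_transition_coeffs hG₁ hG₂
  have hper : ∀ n, ∀ t : ℂ, t.re < a → c n (t + 2 * Real.pi * Complex.I) = c n t :=
    fun n t ht => transition_coeffs_periodic ha0 hG₁ hG₂ hcd hc (by simp) h₁ h₂ n ht
  have hbd : ∀ b < a, ∀ ε > 0, ∃ C R : ℝ, 0 < C ∧ 0 < R ∧ ∀ t : ℂ, t.re ≤ b → ∀ n,
      ‖c n t‖ ≤ C * (R * Real.exp (ε * ‖t‖)) ^ n := by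
    intro b hb ε hε
    obtain ⟨C, R, hC, hR, h⟩ :=
      exists_transition_coeff_bound hlam hH₁ hH₂ hE₁ hE₂ hb hε
    refine ⟨C, R, hC, hR, fun t ht n => ?_⟩
    obtain ⟨φ, hφ⟩ := exists_isTransition hG₁ hG₂ (ht.trans_lt hb)
    rw [hc t (ht.trans_lt hb) φ hφ n]
    exact h t ht φ hφ n
  have hdesc : ∀ n, ∃ g : ℂ → ℂ, DifferentiableOn ℂ g (Metric.ball 0 r) ∧
      ∀ t : ℂ, t.re < a → g (x₀ * Complex.exp t) = c n t := by
    intro n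
    have hn : (0 : ℝ) < n + 1 := by positivity
    -- `ε` is chosen so that `n * ε < 1 / 2`, hence a pole at the origin is impossible
    obtain ⟨C, R, hC, hR, h⟩ := hbd 0 ha0 (1 / (2 * (n + 1))) (by positivity)
    refine exists_descent hx₀ ha0 ha (hcd n) (hper n) (C := C * R ^ n) fun t ht => ?_
    refine (h t ht n).trans ?_
    rw [mul_pow, ← mul_assoc, ← Real.exp_nat_mul]
    have h3 : (n : ℝ) * (1 / (2 * (n + 1)) * ‖t‖) ≤ ‖t‖ / 2 := by
      have h4 : (n : ℝ) * (1 / (2 * (n + 1))) ≤ 1 / 2 := by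
        rw [mul_one_div, div_le_div_iff₀ (by positivity) (by norm_num)]
        linarith
      have := mul_le_mul_of_nonneg_right h4 (norm_nonneg t)
      linarith
    gcongr
  choose g hgd hgc using hdesc
  have hr : 0 < r := (norm_nonneg _).trans_lt ((ha 0).1 (by simpa using ha0))
  have hx₀p : 0 < ‖x₀‖ := norm_pos_iff.2 hx₀
  have hcover : ∀ x : ℂ, x ≠ 0 → ‖x‖ < r → ∃ t : ℂ, t.re < a ∧ x₀ * Complex.exp t = x :=
    fun x hx hxr => ⟨Complex.log (x / x₀),
      by rw [ha, mul_exp_log_div hx₀ hx]; exact hxr, mul_exp_log_div hx₀ hx⟩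
  -- geometric bounds on discs, by the maximum principle and the bounds on their boundary circles
  have hloc : ∀ x : ℂ, ‖x‖ < r → ∃ ρ C A : ℝ, ‖x‖ < ρ ∧ ρ < r ∧ 0 < C ∧ 0 < A ∧
      ∀ n, ∀ z ∈ Metric.ball (0 : ℂ) ρ, ‖g n z‖ ≤ C * A ^ n := by
    intro x hx
    obtain ⟨ρ, hxρ, hρr⟩ := exists_between hx
    have hρ0 : 0 < ρ := (norm_nonneg x).trans_lt hxρ
    set b := Real.log (ρ / ‖x₀‖) with hb
    have hre : ∀ z : ℂ, ‖z‖ = ρ → (Complex.log (z / x₀)).re = b := by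
      intro z hz
      rw [Complex.log_re, norm_div, hz]
    have hba : b < a := by
      have h1 := hre ρ (by simp [hρ0.le])
      rw [← h1, ha, mul_exp_log_div hx₀ (by exact_mod_cast hρ0.ne')]
      simpa [abs_of_pos hρ0] using hρr
    obtain ⟨C, R, hC, hR, h⟩ := hbd b hba 1 one_pos
    refine ⟨ρ, C, R * Real.exp (|b| + Real.pi), hxρ, hρr, hC, by positivity, fun n z hz => ?_⟩
    refine Complex.norm_le_of_forall_mem_frontier_norm_le (U := Metric.ball (0 : ℂ) ρ)
      Metric.isBounded_ball (((hgd n).mono ?_).diffContOnCl_ball subset_rfl) (fun w hw => ?_)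
      (subset_closure hz)
    · exact Metric.closedBall_subset_ball hρr
    · rw [frontier_ball _ hρ0.ne'] at hw
      have hw' : ‖w‖ = ρ := by simpa using hw
      have hw0 : w ≠ 0 := norm_pos_iff.1 (hw' ▸ hρ0)
      set t := Complex.log (w / x₀) with ht
      have htb : t.re = b := hre w hw'
      have h1 := hgc n t (htb ▸ hba)
      rw [ht, mul_exp_log_div hx₀ hw0, ← ht] at h1
      rw [h1]
      refine (h t htb.le n).trans ?_
      rw [one_mul]
      have h2 : ‖t‖ ≤ |b| + Real.pi := by
        have := norm_log_le (w / x₀)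
        rwa [norm_div, hw'] at this
      gcongr
  have hev : ∀ t : ℂ, t.re < a → ∃ φ, IsTransition (fun p => E₁ (H₁ p)) (fun p => E₂ (H₂ p)) t φ :=
    fun t ht => exists_isTransition hG₁ hG₂ ht
  have hg0 : ∀ x : ℂ, x ≠ 0 → ‖x‖ < r → g 0 x = 0 := by
    intro x hx hxr
    obtain ⟨t, hta, rfl⟩ := hcover x hx hxr
    obtain ⟨φ, hφ⟩ := hev t hta
    rw [hgc 0 t hta, hc t hta φ hφ 0, fiberCoeff_zero, hφ.zero.self_of_nhds]
  have hg1 : ∀ x : ℂ, x ≠ 0 → ‖x‖ < r → g 1 x = deriv E₁ 0 / deriv E₂ 0 := by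
    intro x hx hxr
    obtain ⟨t, hta, rfl⟩ := hcover x hx hxr
    obtain ⟨φ, hφ⟩ := hev t hta
    rw [hgc 1 t hta, hc t hta φ hφ 1, fiberCoeff_one hφ.analyticAt]
    have hφ0 : φ (t, 0) = 0 := hφ.zero.self_of_nhds
    have d1 := hasDerivAt_partialY (hG₁.analyticAt t hta).differentiableAt
    have d2 := hasDerivAt_comp_pair (F := fun p => E₂ (H₂ p)) (u := fun _ => t)
      (v := fun y => φ (t, y)) (s := 0)
      (by simp only [hφ0]; exact (hG₂.analyticAt t hta).differentiableAt)
      (hasDerivAt_const (0 : ℂ) t) (hasDerivAt_partialY hφ.analyticAt.differentiableAt)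
    have d3 := d2.congr_of_eventuallyEq (f₁ := fun y => E₁ (H₁ (t, y)))
      (by filter_upwards [eventually_fiber hφ.eq] with y hy using hy.symm)
    have d4 := d1.unique d3
    simp only [hφ0, zero_mul, zero_add] at d4
    rw [hH₁.partialY_comp hE₁ hta, hH₂.partialY_comp hE₂ hta] at d4
    have hexp := Complex.exp_ne_zero (-lam * t)
    rw [eq_div_iff hE₂.2.2]
    refine mul_right_cancel₀ hexp ?_
    linear_combination -d4
  have hext : ∀ n (v : ℂ), (∀ x : ℂ, x ≠ 0 → ‖x‖ < r → g n x = v) →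
      ∀ x : ℂ, ‖x‖ < r → g n x = v := by
    intro n v hv x hx
    by_cases hx0 : x = 0
    · subst hx0
      have h1 : Tendsto (g n) (𝓝[≠] 0) (𝓝 (g n 0)) :=
        ((hgd n).differentiableAt (Metric.ball_mem_nhds 0 hr)).continuousAt.tendsto.mono_left
          nhdsWithin_le_nhds
      refine tendsto_nhds_unique h1 (tendsto_const_nhds.congr' ?_)
      filter_upwards [self_mem_nhdsWithin,
        nhdsWithin_le_nhds (Metric.ball_mem_nhds (0 : ℂ) hr)] with z hz hzr
      exact (hv z hz (by simpa using hzr)).symm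
    · exact hv x hx0 hx
  refine ⟨fun p => ∑' n, g n p.1 * p.2 ^ n, fun x hx => ?_, fun t ht => ?_⟩
  · obtain ⟨ρ, C, A, hxρ, hρr, hC, hA, hgb⟩ := hloc x hx
    have hxm : x ∈ Metric.ball (0 : ℂ) ρ := by simpa using hxρ
    have han := analyticAt_tsum_mul_pow (y := 0) Metric.isOpen_ball
      (fun n => (hgd n).mono (Metric.ball_subset_ball hρr.le)) hgb hA hxm (by simp)
    refine ⟨han, ?_, ?_⟩
    · change ∑' n, g n x * 0 ^ n = 0
      rw [tsum_eq_single 0]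
      · simp [hext 0 0 hg0 x hx]
      · intro n hn; simp [hn]
    · rw [← (hasDerivAt_partialY han.differentiableAt).deriv]
      rw [deriv_tsum_mul_pow_zero (h := fun n => g n x) hC.le hA fun n => hgb n x hxm]
      exact hext 1 _ hg1 x hx
  · obtain ⟨φ, hφ⟩ := hev t ht
    obtain ⟨δ, hδ, hball⟩ := Metric.eventually_nhds_iff_ball.1 hφ.analyticAt.eventually_analyticAt
    have hta : ∀ᶠ s : ℂ in 𝓝 t, s.re < a := (isOpen_re_lt a).mem_nhds ht
    have hnear : ∀ᶠ p : ℂ × ℂ in 𝓝 (t, (0 : ℂ)), p.1.re < a ∧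
        IsTransition (fun p => E₁ (H₁ p)) (fun p => E₂ (H₂ p)) p.1 φ :=
      (continuous_fst.tendsto (t, (0 : ℂ))).eventually (hta.and hφ.eventually)
    filter_upwards [hφ.eq, hnear, Metric.ball_mem_nhds _ hδ] with p h3 h4 hp
    obtain ⟨s, y⟩ := p
    rw [← ball_prod_same] at hp
    have hd : DifferentiableOn ℂ (fun y => φ (s, y)) (Metric.ball 0 δ) := by
      intro z hz
      have hz' : (s, z) ∈ Metric.ball (t, (0 : ℂ)) δ := by
        rw [← ball_prod_same]; exact ⟨hp.1, hz⟩
      exact (hasDerivAt_partialY (hball _ hz').differentiableAt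
        ).differentiableAt.differentiableWithinAt
    have hsum := hasSum_fiberCoeff hd (y := y) (by simpa using hp.2)
    have h5 : ∑' n, g n (x₀ * Complex.exp s) * y ^ n = φ (s, y) := by
      rw [← hsum.tsum_eq]
      refine tsum_congr fun n => ?_
      rw [hgc n s h4.1, hc s h4.1 φ h4.2 n]
    change E₂ (H₂ (s, ∑' n, g n (x₀ * Complex.exp s) * y ^ n)) = E₁ (H₁ (s, y))
    rw [h5]
    exact h3

/-! ### The conjugacy -/

/-- Germs over the punctured disc can be tested on the universal cover. -/
lemma eventually_of_coverMap {P : ℂ × ℂ → Prop} {x₀ t : ℂ} (hx₀ : x₀ ≠ 0)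
    (h : ∀ᶠ p in 𝓝 (t, (0 : ℂ)), P (coverMap x₀ p)) :
    ∀ᶠ q in 𝓝 (x₀ * Complex.exp t, (0 : ℂ)), P q := by
  set x := x₀ * Complex.exp t with hx
  have hxne : x ≠ 0 := mul_ne_zero hx₀ (Complex.exp_ne_zero t)
  set s : ℂ × ℂ → ℂ × ℂ := fun q => (t + Complex.log (q.1 / x), q.2) with hs
  have hsc : Tendsto s (𝓝 (x, 0)) (𝓝 (t, 0)) := by
    have h1 : ContinuousAt (fun q : ℂ × ℂ => t + Complex.log (q.1 / x)) (x, 0) := by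
      refine continuousAt_const.add (ContinuousAt.clog (by fun_prop) ?_)
      simp only
      rw [div_self hxne]
      exact Complex.one_mem_slitPlane
    have h2 := (h1.prodMk continuousAt_snd).tendsto
    simpa [hs, div_self hxne] using h2
  have hne : ∀ᶠ q : ℂ × ℂ in 𝓝 (x, (0 : ℂ)), q.1 ≠ 0 :=
    (continuous_fst.tendsto (x, (0 : ℂ))).eventually (isOpen_ne.mem_nhds hxne)
  filter_upwards [hsc.eventually h, hne] with q h1 h2
  have h3 : coverMap x₀ (s q) = q := by
    refine Prod.ext ?_ rfl
    simp only [coverMap, hs]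
    rw [Complex.exp_add, Complex.exp_log (div_ne_zero h2 hxne), ← mul_assoc, ← hx]
    field_simp
  rwa [h3] at h1

/-- An analytic germ along the disc which vanishes over the punctured disc vanishes. -/
lemma eventually_eq_zero_on_disc {r : ℝ} {F : ℂ × ℂ → ℂ}
    (hF : ∀ x : ℂ, ‖x‖ < r → AnalyticAt ℂ F (x, 0))
    (h0 : ∀ x : ℂ, x ≠ 0 → ‖x‖ < r → ∀ᶠ p in 𝓝 (x, (0 : ℂ)), F p = 0) {x : ℂ} (hx : ‖x‖ < r) :
    ∀ᶠ p in 𝓝 (x, (0 : ℂ)), F p = 0 := by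
  by_cases hx0 : x = 0
  · subst hx0
    have hr : 0 < r := by simpa using hx
    obtain ⟨δ, hδ, hball⟩ := Metric.eventually_nhds_iff_ball.1 (hF 0 hx).eventually_analyticAt
    set η := min δ r / 2 with hη
    have hm : 0 < min δ r := lt_min hδ hr
    have hη0 : 0 < η := half_pos hm
    have hηδ : η < δ := (half_lt_self hm).trans_le (min_le_left _ _)
    have hηr : η < r := (half_lt_self hm).trans_le (min_le_right _ _)
    have hn : ‖(η : ℂ)‖ = η := by simp [abs_of_pos hη0]
    have hmem : ((η : ℂ), (0 : ℂ)) ∈ Metric.ball ((0 : ℂ), (0 : ℂ)) δ := by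
      rw [← ball_prod_same]
      exact ⟨by simpa [abs_of_pos hη0] using hηδ, Metric.mem_ball_self hδ⟩
    exact eventuallyEq_of_analyticOnNhd_ball (G := fun _ => (0 : ℂ)) (fun p hp => hball p hp)
      (fun p _ => analyticAt_const) hmem (Metric.mem_ball_self hδ)
      (h0 η (by exact_mod_cast hη0.ne') (by rwa [hn]))
  · exact h0 x hx0 hx

/-- Composing a first integral with a germ gives a first integral. -/
lemma IsCoverFirstIntegral.pde_comp {lam a : ℝ} {f H : ℂ × ℂ → ℂ} {x₀ : ℂ} {E : ℂ → ℂ}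
    (hH : IsCoverFirstIntegral lam a f x₀ H) (hE : IsDiffGerm E) {t : ℂ} (ht : t.re < a) :
    ∀ᶠ p in 𝓝 (t, (0 : ℂ)), partialX (fun p => E (H p)) p +
      (lam + f (x₀ * Complex.exp p.1, p.2)) * p.2 * partialY (fun p => E (H p)) p = 0 := by
  have hHan := hH.analyticAt t ht
  have hHt : Tendsto H (𝓝 (t, 0)) (𝓝 0) := by
    have := hHan.continuousAt.tendsto
    rwa [hH.zero t ht] at this
  filter_upwards [hH.pde t ht, hHan.eventually_analyticAt,
    hHt.eventually hE.1.eventually_analyticAt] with p h1 h2 h3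
  have h4 : HasFDerivAt (fun p => E (H p)) (deriv E (H p) • fderiv ℂ H p) p :=
    h3.differentiableAt.hasDerivAt.comp_hasFDerivAt p h2.differentiableAt.hasFDerivAt
  have h5 : partialX (fun p => E (H p)) p = deriv E (H p) * partialX H p := by
    simp [partialX, h4.fderiv]
  have h6 : partialY (fun p => E (H p)) p = deriv E (H p) * partialY H p := by
    simp [partialY, h4.fderiv]
  rw [h5, h6]
  linear_combination deriv E (H p) * h1

/-- A fibered map intertwining first integrals maps the first foliation to the second one. -/
lemma transition_map_pde {lam a : ℝ} {f₁ f₂ H₁ H₂ φ : ℂ × ℂ → ℂ} {x₀ : ℂ} {E₁ E₂ : ℂ → ℂ}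
    (hx₀ : x₀ ≠ 0)
    (hH₁ : IsCoverFirstIntegral lam a f₁ x₀ H₁) (hH₂ : IsCoverFirstIntegral lam a f₂ x₀ H₂)
    (hE₁ : IsDiffGerm E₁) (hE₂ : IsDiffGerm E₂) {t : ℂ} (ht : t.re < a)
    (hφan : AnalyticAt ℂ φ (x₀ * Complex.exp t, 0)) (hφ0 : φ (x₀ * Complex.exp t, 0) = 0)
    (hφ : ∀ᶠ p in 𝓝 (t, (0 : ℂ)), E₂ (H₂ (p.1, φ (coverMap x₀ p))) = E₁ (H₁ p)) :
    ∀ᶠ q in 𝓝 (x₀ * Complex.exp t, (0 : ℂ)),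
      q.1 * partialX φ q + (lam + f₁ q) * q.2 * partialY φ q -
        (lam + f₂ (q.1, φ q)) * φ q = 0 := by
  refine eventually_of_coverMap hx₀ ?_
  have htc : Tendsto (coverMap x₀) (𝓝 (t, (0 : ℂ))) (𝓝 (x₀ * Complex.exp t, 0)) :=
    tendsto_coverMap x₀ (t, 0)
  have hφt : Tendsto (fun p => φ (coverMap x₀ p)) (𝓝 (t, (0 : ℂ))) (𝓝 0) := by
    have h1 := hφan.continuousAt.tendsto
    rw [hφ0] at h1
    exact h1.comp htc
  have hσ : Tendsto (fun p : ℂ × ℂ => (p.1, φ (coverMap x₀ p))) (𝓝 (t, 0)) (𝓝 (t, 0)) :=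
    (continuous_fst.tendsto' (t, (0 : ℂ)) t rfl).prodMk_nhds hφt
  have hG₁ := hH₁.isFiberCoordinate hE₁
  have hG₂ := hH₂.isFiberCoordinate hE₂
  have hne := (analyticAt_partialY (hG₂.analyticAt t ht)).continuousAt.eventually_ne
    (hG₂.partialY_ne t ht)
  filter_upwards [hH₁.pde_comp hE₁ ht, hσ.eventually (hH₂.pde_comp hE₂ ht), hσ.eventually hne,
    (hG₁.analyticAt t ht).eventually_analyticAt,
    hσ.eventually (hG₂.analyticAt t ht).eventually_analyticAt,
    htc.eventually hφan.eventually_analyticAt, hφ.eventually_nhds] with p k1 k2 k3 k4 k5 k6 k7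
  obtain ⟨s, y⟩ := p
  set x := x₀ * Complex.exp s with hx
  have hcx : coverMap x₀ (s, y) = (x, y) := rfl
  simp only [hcx] at k2 k3 k5 k6 ⊢
  -- differentiate the relation in both variables
  have dφX := hasDerivAt_comp_pair (F := φ) (u := fun s => x₀ * Complex.exp s)
    (v := fun _ => y) (s := s) k6.differentiableAt
    ((Complex.hasDerivAt_exp s).const_mul x₀) (hasDerivAt_const s y)
  have dφY := hasDerivAt_partialY (F := φ) (x := x) (y := y) k6.differentiableAt
  have dX := hasDerivAt_comp_pair (F := fun p => E₂ (H₂ p)) (u := id)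
    (v := fun s => φ (x₀ * Complex.exp s, y)) (s := s) k5.differentiableAt (hasDerivAt_id s) dφX
  have dY := hasDerivAt_comp_pair (F := fun p => E₂ (H₂ p)) (u := fun _ => s)
    (v := fun y => φ (x, y)) (s := y) k5.differentiableAt (hasDerivAt_const y s) dφY
  have eX := (hasDerivAt_partialX k4.differentiableAt).unique
    (dX.congr_of_eventuallyEq (by filter_upwards [eventually_base k7] with z hz using hz.symm))
  have eY := (hasDerivAt_partialY k4.differentiableAt).unique
    (dY.congr_of_eventuallyEq (by filter_upwards [eventually_fiber k7] with z hz using hz.symm))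
  simp only [id, zero_mul, one_mul, zero_add, add_zero, ← hx] at eX eY k1 k2
  refine (mul_eq_zero.1 ?_).resolve_right k3
  linear_combination k1 - k2 - eX - (lam + f₁ (x, y)) * y * eY

/-- A fibered map whose second component satisfies the conjugacy equation pulls back the second
foliation to the first one. -/
lemma wedgeZero_pullback {lam : ℂ} {f₁ f₂ φ : ℂ × ℂ → ℂ} {q : ℂ × ℂ} (hφ : AnalyticAt ℂ φ q)
    (h : q.1 * partialX φ q + (lam + f₁ q) * q.2 * partialY φ q -
      (lam + f₂ (q.1, φ q)) * φ q = 0) :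
    WedgeZero (pullback (fun p => (p.1, φ p)) (form lam f₂) q) (form lam f₁ q) := by
  have hd : HasFDerivAt (fun p : ℂ × ℂ => (p.1, φ p))
      ((ContinuousLinearMap.fst ℂ ℂ ℂ).prod (fderiv ℂ φ q)) q :=
    hasFDerivAt_fst.prodMk hφ.differentiableAt.hasFDerivAt
  intro u v
  simp only [pullback, hd.fderiv, form, ContinuousLinearMap.comp_apply, _root_.sub_apply,
    _root_.smul_apply, ContinuousLinearMap.prod_apply, ContinuousLinearMap.coe_fst',
    ContinuousLinearMap.coe_snd', smul_eq_mul, fderiv_apply_eq]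
  linear_combination q.1 * (u.1 * v.2 - u.2 * v.1) * h

/-- First integrals on the universal cover which have the same monodromy, up to composition with
germs `E₁` and `E₂`, give a conjugacy of the foliations over the whole disc. -/
theorem fiberedConjugate_of_coverFirstIntegrals {lam a r : ℝ} (hlam : lam ≤ 0)
    {f₁ f₂ H₁ H₂ : ℂ × ℂ → ℂ} {x₀ : ℂ} {E₁ E₂ μ : ℂ → ℂ} (hx₀ : x₀ ≠ 0) (ha0 : 0 < a)
    (ha : ∀ t : ℂ, t.re < a ↔ ‖x₀ * Complex.exp t‖ < r)
    (hf₁ : AnalyticOnNhd ℂ f₁ (axisDisc r)) (hf₂ : AnalyticOnNhd ℂ f₂ (axisDisc r))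
    (hH₁ : IsCoverFirstIntegral lam a f₁ x₀ H₁) (hH₂ : IsCoverFirstIntegral lam a f₂ x₀ H₂)
    (hE₁ : IsDiffGerm E₁) (hE₂ : IsDiffGerm E₂)
    (h₁ : ∀ᶠ p in 𝓝 ((0 : ℂ), (0 : ℂ)),
      E₁ (H₁ (p.1 + 2 * Real.pi * Complex.I, p.2)) = μ (E₁ (H₁ p)))
    (h₂ : ∀ᶠ p in 𝓝 ((0 : ℂ), (0 : ℂ)),
      E₂ (H₂ (p.1 + 2 * Real.pi * Complex.I, p.2)) = μ (E₂ (H₂ p))) :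
    FiberedConjugate r lam f₁ f₂ (deriv E₁ 0 / deriv E₂ 0) := by
  have hcover : ∀ x : ℂ, x ≠ 0 → ‖x‖ < r → ∃ t : ℂ, t.re < a ∧ x₀ * Complex.exp t = x :=
    fun x hx hxr => ⟨Complex.log (x / x₀),
      by rw [ha, mul_exp_log_div hx₀ hx]; exact hxr, mul_exp_log_div hx₀ hx⟩
  obtain ⟨φ, hφ, hφH⟩ := exists_transition_map hlam hx₀ ha0 ha hH₁ hH₂ hE₁ hE₂ h₁ h₂
  obtain ⟨ψ, hψ, hψH⟩ := exists_transition_map hlam hx₀ ha0 ha hH₂ hH₁ hE₂ hE₁ h₂ h₁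
  have hmap : ∀ {φ : ℂ × ℂ → ℂ} {x : ℂ}, AnalyticAt ℂ φ (x, 0) → φ (x, 0) = 0 →
      Tendsto (fun p : ℂ × ℂ => (p.1, φ p)) (𝓝 (x, 0)) (𝓝 (x, 0)) := by
    intro φ x h1 h2
    have h3 := h1.continuousAt.tendsto
    rw [h2] at h3
    exact (continuous_fst.tendsto' (x, (0 : ℂ)) x rfl).prodMk_nhds h3
  have han : ∀ {F φ : ℂ × ℂ → ℂ} {x : ℂ}, AnalyticAt ℂ F (x, 0) → AnalyticAt ℂ φ (x, 0) →
      φ (x, 0) = 0 → AnalyticAt ℂ (fun p : ℂ × ℂ => F (p.1, φ p)) (x, 0) := by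
    intro F φ x h1 h2 h3
    exact h1.comp_of_eq (f := fun p : ℂ × ℂ => (p.1, φ p)) (analyticAt_fst.prod h2) (by simp [h3])
  -- the two maps are inverse to each other near the disc
  have hinv : ∀ {H₁ H₂ φ ψ : ℂ × ℂ → ℂ} {E₁ E₂ : ℂ → ℂ},
      IsFiberCoordinate a (fun p => E₁ (H₁ p)) →
      (∀ x : ℂ, ‖x‖ < r → AnalyticAt ℂ φ (x, 0) ∧ φ (x, 0) = 0) →
      (∀ x : ℂ, ‖x‖ < r → AnalyticAt ℂ ψ (x, 0) ∧ ψ (x, 0) = 0) →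
      (∀ t : ℂ, t.re < a → ∀ᶠ p in 𝓝 (t, (0 : ℂ)),
        E₂ (H₂ (p.1, φ (coverMap x₀ p))) = E₁ (H₁ p)) →
      (∀ t : ℂ, t.re < a → ∀ᶠ p in 𝓝 (t, (0 : ℂ)),
        E₁ (H₁ (p.1, ψ (coverMap x₀ p))) = E₂ (H₂ p)) →
      ∀ x : ℂ, ‖x‖ < r → ∀ᶠ p in 𝓝 (x, (0 : ℂ)), ψ (p.1, φ p) - p.2 = 0 := by
    intro H₁ H₂ φ ψ E₁ E₂ hG₁ hφ hψ hφH hψH x hx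
    refine eventually_eq_zero_on_disc (F := fun p => ψ (p.1, φ p) - p.2) (r := r)
      (fun x hx => (han (hψ x hx).1 (hφ x hx).1 (hφ x hx).2).sub analyticAt_snd) ?_ hx
    intro x hx0 hx
    obtain ⟨t, hta, rfl⟩ := hcover x hx0 hx
    refine eventually_of_coverMap hx₀ ?_
    have htc : Tendsto (coverMap x₀) (𝓝 (t, (0 : ℂ))) (𝓝 (x₀ * Complex.exp t, 0)) :=
      tendsto_coverMap x₀ (t, 0)
    have hφt : Tendsto (fun p : ℂ × ℂ => (p.1, φ (coverMap x₀ p))) (𝓝 (t, 0)) (𝓝 (t, 0)) := by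
      have h1 := (hφ _ hx).1.continuousAt.tendsto
      rw [(hφ _ hx).2] at h1
      exact (continuous_fst.tendsto' (t, (0 : ℂ)) t rfl).prodMk_nhds (h1.comp htc)
    have hψφt : Tendsto (fun p : ℂ × ℂ => (p.1, ψ (x₀ * Complex.exp p.1, φ (coverMap x₀ p))))
        (𝓝 (t, 0)) (𝓝 (t, 0)) := by
      have h1 := (hψ _ hx).1.continuousAt.tendsto
      rw [(hψ _ hx).2] at h1
      exact (continuous_fst.tendsto' (t, (0 : ℂ)) t rfl).prodMk_nhds
        (h1.comp (htc.comp hφt))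
    have h := hG₁.eventually_injective hta hψφt tendsto_id (Eventually.of_forall fun _ => rfl) ?_
    · filter_upwards [h] with p hp
      exact sub_eq_zero.2 (congrArg Prod.snd hp)
    · filter_upwards [hφH t hta, hφt.eventually (hψH t hta)] with p e1 e2
      exact e2.trans e1
  have hφψ := hinv (hH₁.isFiberCoordinate hE₁) (fun x hx => ⟨(hφ x hx).1, (hφ x hx).2.1⟩)
    (fun x hx => ⟨(hψ x hx).1, (hψ x hx).2.1⟩) hφH hψH
  have hψφ := hinv (hH₂.isFiberCoordinate hE₂) (fun x hx => ⟨(hψ x hx).1, (hψ x hx).2.1⟩)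
    (fun x hx => ⟨(hφ x hx).1, (hφ x hx).2.1⟩) hψH hφH
  have hpde : ∀ x : ℂ, ‖x‖ < r → ∀ᶠ q in 𝓝 (x, (0 : ℂ)),
      q.1 * partialX φ q + (lam + f₁ q) * q.2 * partialY φ q -
        (lam + f₂ (q.1, φ q)) * φ q = 0 := by
    intro x hx
    refine eventually_eq_zero_on_disc (r := r) (fun x hx => ?_) ?_ hx
    · obtain ⟨h1, h2, -⟩ := hφ x hx
      have e1 := hf₁ (x, 0) ⟨hx, rfl⟩
      have e2 := han (hf₂ (x, 0) ⟨hx, rfl⟩) h1 h2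
      exact ((analyticAt_fst.mul (analyticAt_partialX h1)).add
        (((analyticAt_const.add e1).mul analyticAt_snd).mul (analyticAt_partialY h1))).sub
          ((analyticAt_const.add e2).mul h1)
    · intro x hx0 hx
      obtain ⟨t, hta, rfl⟩ := hcover x hx0 hx
      exact transition_map_pde hx₀ hH₁ hH₂ hE₁ hE₂ hta (hφ _ hx).1 (hφ _ hx).2.1 (hφH t hta)
  set Φ : ℂ × ℂ → ℂ × ℂ := fun p => (p.1, φ p) with hΦ
  set Ψ : ℂ × ℂ → ℂ × ℂ := fun p => (p.1, ψ p) with hΨ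
  -- points near which the map is analytic, has the other one as left inverse and conjugates
  set A₁ : Set (ℂ × ℂ) := {p | ∀ᶠ q in 𝓝 p, AnalyticAt ℂ f₁ q ∧ AnalyticAt ℂ φ q ∧
    ψ (q.1, φ q) - q.2 = 0 ∧ q.1 * partialX φ q + (lam + f₁ q) * q.2 * partialY φ q -
        (lam + f₂ (q.1, φ q)) * φ q = 0} with hA₁
  set A₂ : Set (ℂ × ℂ) := {p | ∀ᶠ q in 𝓝 p, AnalyticAt ℂ f₂ q ∧ AnalyticAt ℂ ψ q ∧
    φ (q.1, ψ q) - q.2 = 0} with hA₂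
  have hA₁o : IsOpen A₁ := isOpen_setOfPred_eventually_nhds
  have hA₂o : IsOpen A₂ := isOpen_setOfPred_eventually_nhds
  have hA₁s : ∀ p ∈ A₁, AnalyticAt ℂ f₁ p ∧ AnalyticAt ℂ Φ p ∧ Ψ (Φ p) = p := by
    intro p hp
    obtain ⟨k1, k2, k3, -⟩ := Filter.Eventually.self_of_nhds hp
    exact ⟨k1, analyticAt_fst.prod k2, Prod.ext rfl (sub_eq_zero.1 k3)⟩
  have hA₂s : ∀ p ∈ A₂, AnalyticAt ℂ f₂ p ∧ AnalyticAt ℂ Ψ p ∧ Φ (Ψ p) = p := by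
    intro p hp
    obtain ⟨k1, k2, k3⟩ := Filter.Eventually.self_of_nhds hp
    exact ⟨k1, analyticAt_fst.prod k2, Prod.ext rfl (sub_eq_zero.1 k3)⟩
  have hΔ₁ : ∀ x : ℂ, ‖x‖ < r → (x, (0 : ℂ)) ∈ A₁ := fun x hx =>
    ((hf₁ _ ⟨hx, rfl⟩).eventually_analyticAt.and ((hφ x hx).1.eventually_analyticAt.and
      ((hφψ x hx).and (hpde x hx))))
  have hΔ₂ : ∀ x : ℂ, ‖x‖ < r → (x, (0 : ℂ)) ∈ A₂ := fun x hx =>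
    ((hf₂ _ ⟨hx, rfl⟩).eventually_analyticAt.and ((hψ x hx).1.eventually_analyticAt.and
      (hψφ x hx)))
  have hΦΔ : ∀ x : ℂ, ‖x‖ < r → Φ (x, 0) = (x, 0) := fun x hx =>
    Prod.ext rfl (hφ x hx).2.1
  have hΨΔ : ∀ x : ℂ, ‖x‖ < r → Ψ (x, 0) = (x, 0) := fun x hx =>
    Prod.ext rfl (hψ x hx).2.1
  refine ⟨A₁ ∩ Φ ⁻¹' A₂, A₂ ∩ Ψ ⁻¹' A₁, Φ, Ψ, ?_, ?_, ?_, ?_, fun p hp => (hA₁s p hp.1).1,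
    fun p hp => (hA₂s p hp.1).1, fun p hp => (hA₁s p hp.1).2.1, fun p hp => (hA₂s p hp.1).2.1,
    fun p hp => ?_, fun p hp => ?_, ⟨fun p hp => (hA₁s p hp.1).2.2, fun p hp => (hA₂s p hp.1).2.2⟩,
    fun p _ => rfl, fun x hx => ?_, fun p hp => ?_⟩
  · exact ContinuousOn.isOpen_inter_preimage
      (fun p hp => (hA₁s p hp).2.1.continuousAt.continuousWithinAt) hA₁o hA₂o
  · exact ContinuousOn.isOpen_inter_preimage
      (fun p hp => (hA₂s p hp).2.1.continuousAt.continuousWithinAt) hA₂o hA₁o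
  · rintro ⟨x, y⟩ ⟨hx, hy⟩
    obtain rfl : y = 0 := hy
    refine ⟨hΔ₁ x hx, ?_⟩
    rw [Set.mem_preimage, hΦΔ x hx]
    exact hΔ₂ x hx
  · rintro ⟨x, y⟩ ⟨hx, hy⟩
    obtain rfl : y = 0 := hy
    refine ⟨hΔ₂ x hx, ?_⟩
    rw [Set.mem_preimage, hΨΔ x hx]
    exact hΔ₁ x hx
  · refine ⟨hp.2, ?_⟩
    rw [Set.mem_preimage, (hA₁s p hp.1).2.2]
    exact hp.1
  · refine ⟨hp.2, ?_⟩
    rw [Set.mem_preimage, (hA₂s p hp.1).2.2]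
    exact hp.1
  · obtain ⟨k1, k2, k3⟩ := hφ x hx
    have h := (hasDerivAt_partialY k1.differentiableAt).isLittleO
    rw [k3] at h
    simpa [k2, mul_comm, hΦ] using h
  · obtain ⟨-, k2, -, k4⟩ := Filter.Eventually.self_of_nhds hp.1
    exact wedgeZero_pullback k2 k4

lemma IsDiffGerm.comp {ψ χ : ℂ → ℂ} (hψ : IsDiffGerm ψ) (hχ : IsDiffGerm χ) :
    IsDiffGerm (fun w => ψ (χ w)) := by
  obtain ⟨h1, h2, h3⟩ := hψ
  obtain ⟨k1, k2, k3⟩ := hχ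
  refine ⟨h1.comp_of_eq k1 k2, by simp [k2, h2], ?_⟩
  have h4 : HasDerivAt ψ (deriv ψ 0) (χ 0) := by
    rw [k2]; exact h1.differentiableAt.hasDerivAt
  have h5 : HasDerivAt (fun w => ψ (χ w)) (deriv ψ 0 * deriv χ 0) 0 :=
    h4.comp (0 : ℂ) k1.differentiableAt.hasDerivAt
  rw [h5.deriv]
  exact mul_ne_zero h3 k3

end SaddleFoliation

theorem theorem3p1 (lam : ℝ) (hlam : lam ≤ 0) (r : ℝ) (f₁ f₂ : ℂ × ℂ → ℂ)
    (hf₁ : AnalyticOnNhd ℂ f₁ (axisDisc r)) (hf₂ : AnalyticOnNhd ℂ f₂ (axisDisc r))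
    (hf₁_zero : ∀ p ∈ axisDisc r, f₁ p = 0) (hf₂_zero : ∀ p ∈ axisDisc r, f₂ p = 0)
    (x₀ : ℂ) (hx₀ : 0 < ‖x₀‖) (hx₀r : ‖x₀‖ < r) :
    (SameHolonomy lam f₁ f₂ x₀ → ∃ c : ℂ, c ≠ 0 ∧ FiberedConjugate r lam f₁ f₂ c) ∧
    (SameNormalizedHolonomy lam f₁ f₂ x₀ → FiberedConjugate r lam f₁ f₂ 1) := by
  have hx₀' : x₀ ≠ 0 := norm_pos_iff.1 hx₀
  set a := Real.log (r / ‖x₀‖) with ha_def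
  have hr : 0 < r := hx₀.trans hx₀r
  have ha0 : 0 < a := Real.log_pos ((one_lt_div hx₀).2 hx₀r)
  have ha : ∀ t : ℂ, t.re < a ↔ ‖x₀ * Complex.exp t‖ < r := by
    intro t
    rw [ha_def, Real.lt_log_iff_exp_lt (div_pos hr hx₀), norm_mul, Complex.norm_exp,
      lt_div_iff₀' hx₀]
  obtain ⟨H₁, hH₁⟩ :=
    exists_coverFirstIntegral hlam hf₁ hf₁_zero (fun t => (ha t).1) ha0
  obtain ⟨H₂, hH₂⟩ :=
    exists_coverFirstIntegral hlam hf₂ hf₂_zero (fun t => (ha t).1) ha0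
  constructor
  · rintro ⟨h₁, h₂, φ₁, φ₂, ψ, hm₁, hm₂, hψ, hconj⟩
    obtain ⟨hχ₁, -, ht₁⟩ := hm₁.translate ha0 hx₀' hH₁
    obtain ⟨hχ₂, -, ht₂⟩ := hm₂.translate ha0 hx₀' hH₂
    have hE₁ := hψ.comp hχ₁
    refine ⟨_, div_ne_zero hE₁.2.2 hχ₂.2.2, fiberedConjugate_of_coverFirstIntegrals hlam hx₀' ha0
      ha hf₁ hf₂ hH₁ hH₂ hE₁ hχ₂ (μ := φ₂) ?_ ht₂⟩
    have h0 : (0 : ℂ).re < a := by simpa using ha0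
    have hG := hH₁.isFiberCoordinate hχ₁
    have htend : Tendsto (fun p => h₁ (x₀, H₁ p)) (𝓝 ((0 : ℂ), (0 : ℂ))) (𝓝 0) := by
      have := (hG.analyticAt 0 h0).continuousAt.tendsto
      rwa [hG.zero 0 h0] at this
    filter_upwards [ht₁, htend.eventually hconj] with p e1 e2
    rw [e1]
    exact e2
  · rintro ⟨h₁, h₂, φ, hm₁, hm₂, hd⟩
    obtain ⟨hχ₁, hd₁, ht₁⟩ := hm₁.translate ha0 hx₀' hH₁
    obtain ⟨hχ₂, hd₂, ht₂⟩ := hm₂.translate ha0 hx₀' hH₂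
    have h := fiberedConjugate_of_coverFirstIntegrals hlam hx₀' ha0 ha hf₁ hf₂ hH₁ hH₂ hχ₁ hχ₂
      ht₁ ht₂
    have e : partialY h₁ (x₀, 0) = partialY h₂ (x₀, 0) := by rw [partialY, partialY, hd]
    rwa [hd₁, hd₂, e, div_self (by rw [← hd₂]; exact hχ₂.2.2)] at h
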